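/- Let $\mathbb{O}$ be the algebra of complex octonions, that is, the complexification of the compact real Cayley algebra $\mathbb{O}_c$, with Cayley conjugation $a\mapsto\widetilde a$ (complex linear), norm $n$, bilinear form $(a:b)=n(a+b)-n(a)-n(b)$ and complex conjugation $a\mapsto\overline a$ with respect to $\mathbb{O}_c$. Let $H_3(\mathbb{O})$ be the $27$-dimensional complex space of $3\times3$ matrices $$a=\begin{pmatrix}\alpha_1&a_3&\widetilde{a_2}\\ \widetilde{a_3}&\alpha_2&a_1\\ a_2&\widetilde{a_1}&\alpha_3\end{pmatrix}=\sum_i\alpha_ie_i+\sum_iF_i(a_i)\qquad(\alpha_i\in\mathbb{C},\ a_i\in\mathbb{O}),$$ with $(a:b)=\sum_i\alpha_i\beta_i+\sum_i(a_i:b_i)$, $(a\mid b)=(a:\overline b)$ (entrywise complex conjugation), adjoint $$a^{\#}=\sum_i(\alpha_j\alpha_k-n(a_i))\,e_i+\sum_iF_i\big((a_ja_k-\alpha_i\widetilde{a_i})^{\sim}\big)$$ ($(i,j,k)$ an even permutation of $(1,2,3)$), Freudenthal product $a\times b=(a+b)^{\#}-a^{\#}-b^{\#}$, and triple product $$D(x,y)z=\{xyz\}=(x\mid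 y)z+(z\mid y)x-(x\times z)\times\overline y .$$ Let $W=\mathcal F_2\oplus\mathcal F_3$, where $\mathcal F_i=\{F_i(a):a\in\mathbb{O}\}$; it is closed under the triple product. Below, all notions are those of $W$ with the restricted product, $Q(x)y=\frac12\{xyx\}$, and $B(x,y)=I-D(x,y)+Q(x)Q(y)$. A tripotent is an $x$ with $Q(x)x=x$; tripotents $x,y$ are orthogonal if $D(x,y)=0$; a nonzero tripotent is minimal if it is not a sum of two nonzero orthogonal tripotents; a tripotent has rank $k$ if it is a sum of $k$ pairwise orthogonal minimal tripotents; a frame is a maximal finite sequence of pairwise orthogonal minimal tripotents. For a frame $(c_1,\dots,c_r)$ and $0\le i\le j\le r$ let $V_{ij}=\{z: D(c_k,c_k)z=(\delta_{ik}+\delta_{jk})z,\ 1\le k\le r\}$. Then: 1. $\dim_{\mathbb{C}}W=16$, and $W$ is a Hermitian Jordan triple system: $\{xyz\}$ is $\mathbb{C}$-linear and symmetric in $x,z$, antilinear in $y$, and $D(x,y)Q(x)=Q(x)D(y,x)$, $D(Q(x)y,y)=D(x,Q(y)x)$. It is positive: if $x\neq0$, $\lambda\in\mathbb{C}$ and $Q(x)x=\lambda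 x$, then $\lambda$ is real and $\lambda>0$; also, the form $\operatorname{Tr}D(x,y)$ is Hermitian and positive definite. It is simple: the triple product is not zero and the only ideals (complex subspaces $I$ with $\{xyz\}\in I$ whenever one of $x,y,z$ is in $I$) are $0$ and $W$. 2. The numerical invariants of $W$ are $a=6$, $b=4$, $r=2$, $g=12$. That is: the rank $r$, the degree of the generic minimal polynomial, equivalently the largest dimension of a subspace spanned by powers $x^{(1,y)}=x$, $x^{(k+1,y)}=\frac12D(x,y)x^{(k,y)}$ with $x,y\in W$, is $2$; frames exist, and every frame has exactly $2$ elements and satisfies $\dim V_{12}=a=6$ and $\dim V_{01}=\dim V_{02}=b=4$; and $g=2+a(r-1)+b=12$. 3. For all $x,y\in W$, with trace and determinant of $\mathbb{C}$-linear operators on $W$, $$\operatorname{Tr}D(x,y)=12\,(x\mid y),\qquad \operatorname{Det}B(x,y)=\big(1-(x\mid y)+(x^{\#}\mid y^{\#})\big)^{12}.$$ 4. The set of tripotents of $W$ is $\mathcal E'=\mathcal E'_0\cup\mathcal E'_1\cup\mathcal E'_2$, where $\mathcal E'_k$ is the set of tripotents of rank $k$, and $$\mathcal E'_0=\{0\},\quad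 \mathcal E'_1=\{x\in W:(x\mid x)=1,\ x^{\#}=0\},\quad \mathcal E'_2=\{x\in W:(x\mid x)=2,\ (x^{\#}\mid x^{\#})=1\}.$$ -/

import Mathlib

open scoped ComplexConjugate Quaternion

noncomputable section

namespace ExceptionalJTS

/-! ### Octonions -/

/-- The Cayley algebra over `R` obtained from the quaternions by the Cayley-Dickson process with
parameter `-1`: an element is `fst + v * snd`, where `fst`, `snd` are quaternions and `v ^ 2 = -1`.
`Octonion ℝ` is the compact real algebra of octonions; as all structure constants are integers,
`Octonion ℂ` is its complexification. -/
@[ext]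
structure Octonion (R : Type) [CommRing R] where
  fst : ℍ[R]
  snd : ℍ[R]

namespace Octonion

variable {R : Type} [CommRing R]

/-- An octonion as a pair of quaternions. -/
def equivProd (R : Type) [CommRing R] : Octonion R ≃ ℍ[R] × ℍ[R] where
  toFun x := (x.fst, x.snd)
  invFun p := ⟨p.1, p.2⟩
  left_inv _ := rfl
  right_inv _ := rfl

instance : AddCommGroup (Octonion R) := (equivProd R).addCommGroup

instance : Module R (Octonion R) := (equivProd R).module R

@[simp] theorem fst_zero : (0 : Octonion R).fst = 0 := rfl
@[simp] theorem snd_zero : (0 : Octonion R).snd = 0 := rfl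
@[simp] theorem fst_add (x y : Octonion R) : (x + y).fst = x.fst + y.fst := rfl
@[simp] theorem snd_add (x y : Octonion R) : (x + y).snd = x.snd + y.snd := rfl
@[simp] theorem fst_neg (x : Octonion R) : (-x).fst = -x.fst := rfl
@[simp] theorem snd_neg (x : Octonion R) : (-x).snd = -x.snd := rfl
@[simp] theorem fst_sub (x y : Octonion R) : (x - y).fst = x.fst - y.fst := rfl
@[simp] theorem snd_sub (x y : Octonion R) : (x - y).snd = x.snd - y.snd := rfl
@[simp] theorem fst_smul (c : R) (x : Octonion R) : (c • x).fst = c • x.fst := rfl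
@[simp] theorem snd_smul (c : R) (x : Octonion R) : (c • x).snd = c • x.snd := rfl

/-- The Cayley-Dickson product. -/
instance : Mul (Octonion R) :=
  ⟨fun x y => ⟨x.fst * y.fst - y.snd * star x.snd, star x.fst * y.snd + y.fst * x.snd⟩⟩

theorem mul_def (x y : Octonion R) :
    x * y = ⟨x.fst * y.fst - y.snd * star x.snd, star x.fst * y.snd + y.fst * x.snd⟩ := rfl

/-- The Cayley conjugation, which is `R`-linear. -/
def cayley (x : Octonion R) : Octonion R := ⟨star x.fst, -x.snd⟩

/-- The norm, which is an `R`-valued quadratic form. -/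
def n (x : Octonion R) : R := Quaternion.normSq x.fst + Quaternion.normSq x.snd

/-- The bilinear form `(x : y)` associated with the norm (without a factor `1 / 2`). -/
def bil (x y : Octonion R) : R := n (x + y) - n x - n y

/-- Complex conjugation of the four coordinates of a complex quaternion. -/
def quatConj (q : ℍ[ℂ]) : ℍ[ℂ] := ⟨conj q.re, conj q.imI, conj q.imJ, conj q.imK⟩

@[simp] theorem quatConj_re (q : ℍ[ℂ]) : (quatConj q).re = conj q.re := rfl
@[simp] theorem quatConj_imI (q : ℍ[ℂ]) : (quatConj q).imI = conj q.imI := rfl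
@[simp] theorem quatConj_imJ (q : ℍ[ℂ]) : (quatConj q).imJ = conj q.imJ := rfl
@[simp] theorem quatConj_imK (q : ℍ[ℂ]) : (quatConj q).imK = conj q.imK := rfl

/-- Complex conjugation with respect to the real form `Octonion ℝ`: the eight coordinates are
conjugated one by one. -/
def cconj (x : Octonion ℂ) : Octonion ℂ := ⟨quatConj x.fst, quatConj x.snd⟩

theorem oct_add_mul (x y z : Octonion R) : (x + y) * z = x * z + y * z := by
  ext1 <;> simp [mul_def, add_mul, mul_add] <;> abel

theorem oct_mul_add (x y z : Octonion R) : x * (y + z) = x * y + x * z := by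
  ext1 <;> simp [mul_def, add_mul, mul_add] <;> abel

theorem oct_smul_mul (c : R) (x y : Octonion R) : (c • x) * y = c • (x * y) := by
  ext1 <;> simp [mul_def, smul_sub, smul_add]

theorem oct_mul_smul (c : R) (x y : Octonion R) : x * (c • y) = c • (x * y) := by
  ext1 <;> simp [mul_def, smul_sub, smul_add]

@[simp] theorem oct_zero_mul (x : Octonion R) : 0 * x = 0 := by
  ext1 <;> simp [mul_def]

@[simp] theorem oct_mul_zero (x : Octonion R) : x * 0 = 0 := by
  ext1 <;> simp [mul_def]

theorem cayley_add (x y : Octonion R) : cayley (x + y) = cayley x + cayley y := by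
  ext1
  · simp [cayley]
  · simp [cayley]; abel

theorem cayley_smul (c : R) (x : Octonion R) : cayley (c • x) = c • cayley x := by
  ext1 <;> simp [cayley]

@[simp] theorem cayley_zero : cayley (0 : Octonion R) = 0 := by
  ext1 <;> simp [cayley]

@[simp] theorem cayley_cayley (x : Octonion R) : cayley (cayley x) = x := by
  ext1 <;> simp [cayley]

theorem bil_eq (x y : Octonion R) : bil x y =
    2 * (x.fst.re * y.fst.re + x.fst.imI * y.fst.imI + x.fst.imJ * y.fst.imJ
      + x.fst.imK * y.fst.imK + x.snd.re * y.snd.re + x.snd.imI * y.snd.imI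
      + x.snd.imJ * y.snd.imJ + x.snd.imK * y.snd.imK) := by
  simp [bil, n, Quaternion.normSq_def']
  ring

theorem bil_add_left (x y z : Octonion R) : bil (x + y) z = bil x z + bil y z := by
  simp [bil_eq]; ring

theorem bil_add_right (x y z : Octonion R) : bil x (y + z) = bil x y + bil x z := by
  simp [bil_eq]; ring

theorem bil_smul_left (c : R) (x y : Octonion R) : bil (c • x) y = c * bil x y := by
  simp [bil_eq]; ring

theorem bil_smul_right (c : R) (x y : Octonion R) : bil x (c • y) = c * bil x y := by
  simp [bil_eq]; ring

@[simp] theorem bil_zero_left (x : Octonion R) : bil 0 x = 0 := by simp [bil_eq]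

@[simp] theorem bil_zero_right (x : Octonion R) : bil x 0 = 0 := by simp [bil_eq]

theorem cconj_add (x y : Octonion ℂ) : cconj (x + y) = cconj x + cconj y := by
  ext <;> simp [cconj]

theorem cconj_smul (c : ℂ) (x : Octonion ℂ) : cconj (c • x) = conj c • cconj x := by
  ext <;> simp [cconj]

@[simp] theorem cconj_zero : cconj 0 = 0 := by
  ext <;> simp [cconj]

end Octonion

open Octonion

/-! ### The space of Hermitian 3 by 3 matrices over the complex octonions -/

/-- The space `H₃(𝕆)` of `3 × 3` matrices over the complex octonions that are Hermitian for the
Cayley conjugation `~`. With indices `1, 2, 3` written as `0, 1, 2`, an element `a` stands for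
```
  a.diag 0      a.off 2      ~(a.off 1)
  ~(a.off 2)    a.diag 1     a.off 0
  a.off 1       ~(a.off 0)   a.diag 2
```
-/
@[ext]
structure H3 where
  diag : Fin 3 → ℂ
  off : Fin 3 → Octonion ℂ

namespace H3

/-- An element of `H₃(𝕆)` as the pair of its diagonal and off-diagonal parts. -/
def equivProd : H3 ≃ (Fin 3 → ℂ) × (Fin 3 → Octonion ℂ) where
  toFun a := (a.diag, a.off)
  invFun p := ⟨p.1, p.2⟩
  left_inv _ := rfl
  right_inv _ := rfl

instance : AddCommGroup H3 := equivProd.addCommGroup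

instance : Module ℂ H3 := equivProd.module ℂ

@[simp] theorem diag_zero (i : Fin 3) : (0 : H3).diag i = 0 := rfl
@[simp] theorem off_zero (i : Fin 3) : (0 : H3).off i = 0 := rfl
@[simp] theorem diag_add (a b : H3) (i : Fin 3) : (a + b).diag i = a.diag i + b.diag i := rfl
@[simp] theorem off_add (a b : H3) (i : Fin 3) : (a + b).off i = a.off i + b.off i := rfl
@[simp] theorem diag_sub (a b : H3) (i : Fin 3) : (a - b).diag i = a.diag i - b.diag i := rfl
@[simp] theorem off_sub (a b : H3) (i : Fin 3) : (a - b).off i = a.off i - b.off i := rfl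
@[simp] theorem diag_smul (c : ℂ) (a : H3) (i : Fin 3) : (c • a).diag i = c * a.diag i := rfl
@[simp] theorem off_smul (c : ℂ) (a : H3) (i : Fin 3) : (c • a).off i = c • a.off i := rfl

/-- The matrix `F_i(x)`. -/
def F (i : Fin 3) : Octonion ℂ →ₗ[ℂ] H3 where
  toFun x := ⟨0, Pi.single i x⟩
  map_add' x y := by
    ext1
    · funext j; simp
    · funext j; by_cases h : j = i <;> simp [h]
  map_smul' c x := by
    ext1
    · funext j; simp
    · funext j; by_cases h : j = i <;> simp [h]

/-- The scalar product `(a : b)`, which is `ℂ`-bilinear. -/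
def bil (a b : H3) : ℂ := ∑ i, a.diag i * b.diag i + ∑ i, Octonion.bil (a.off i) (b.off i)

/-- The adjoint `a^#`; here `(i, i + 1, i + 2)` runs through the even permutations. -/
def adj (a : H3) : H3 where
  diag i := a.diag (i + 1) * a.diag (i + 2) - n (a.off i)
  off i := cayley (a.off (i + 1) * a.off (i + 2) - a.diag i • cayley (a.off i))

/-- The Freudenthal product `a × b`. -/
def frd (a b : H3) : H3 := adj (a + b) - adj a - adj b

/-- Complex conjugation with respect to `H₃(𝕆_c)`. -/
def cconj (a : H3) : H3 where
  diag i := conj (a.diag i)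
  off i := Octonion.cconj (a.off i)

/-- The Hermitian scalar product `(a | b)`, linear in `a` and antilinear in `b`. -/
def herm (a b : H3) : ℂ := bil a (cconj b)

theorem diag_frd (a b : H3) (i : Fin 3) : (frd a b).diag i =
    a.diag (i + 1) * b.diag (i + 2) + b.diag (i + 1) * a.diag (i + 2)
      - Octonion.bil (a.off i) (b.off i) := by
  simp [frd, adj, Octonion.bil]; ring

theorem off_frd (a b : H3) (i : Fin 3) : (frd a b).off i =
    cayley (a.off (i + 1) * b.off (i + 2)) + cayley (b.off (i + 1) * a.off (i + 2))
      - a.diag i • b.off i - b.diag i • a.off i := by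
  have hs (x y : Octonion ℂ) : cayley (x - y) = cayley x - cayley y := by
    ext1
    · simp [cayley]
    · simp [cayley]; abel
  simp only [frd, adj, off_sub, off_add, diag_add, oct_add_mul, oct_mul_add, cayley_add, hs,
    cayley_smul, cayley_cayley, smul_add, add_smul]
  abel

theorem frd_add_left (a b c : H3) : frd (a + b) c = frd a c + frd b c := by
  ext1 <;> funext i
  · simp [diag_frd, bil_add_left]; ring
  · simp only [off_frd, off_add, diag_add, oct_add_mul, oct_mul_add, cayley_add, smul_add, add_smul]
    abel

theorem frd_add_right (a b c : H3) : frd a (b + c) = frd a b + frd a c := by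
  ext1 <;> funext i
  · simp [diag_frd, bil_add_right]; ring
  · simp only [off_frd, off_add, diag_add, oct_add_mul, oct_mul_add, cayley_add, smul_add, add_smul]
    abel

theorem frd_smul_left (c : ℂ) (a b : H3) : frd (c • a) b = c • frd a b := by
  ext1 <;> funext i
  · simp [diag_frd, bil_smul_left]; ring
  · simp only [off_frd, off_smul, diag_smul, oct_smul_mul, oct_mul_smul, cayley_smul, smul_add,
      smul_sub, mul_smul]
    rw [smul_comm (b.diag i) c]

theorem frd_smul_right (c : ℂ) (a b : H3) : frd a (c • b) = c • frd a b := by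
  ext1 <;> funext i
  · simp [diag_frd, bil_smul_right]; ring
  · simp only [off_frd, off_smul, diag_smul, oct_smul_mul, oct_mul_smul, cayley_smul, smul_add,
      smul_sub, mul_smul]
    rw [smul_comm (a.diag i) c]

theorem cconj_add (a b : H3) : cconj (a + b) = cconj a + cconj b := by
  ext1 <;> funext i <;> simp [cconj, Octonion.cconj_add]

theorem cconj_smul (c : ℂ) (a : H3) : cconj (c • a) = conj c • cconj a := by
  ext1 <;> funext i <;> simp [cconj, Octonion.cconj_smul]

theorem herm_add_left (a b c : H3) : herm (a + b) c = herm a c + herm b c := by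
  simp only [herm, bil, diag_add, off_add, add_mul, bil_add_left, Finset.sum_add_distrib]; ring

theorem herm_add_right (a b c : H3) : herm a (b + c) = herm a b + herm a c := by
  simp only [herm, bil, cconj_add, diag_add, off_add, mul_add, bil_add_right,
    Finset.sum_add_distrib]; ring

theorem herm_smul_left (c : ℂ) (a b : H3) : herm (c • a) b = c * herm a b := by
  simp only [herm, bil, diag_smul, off_smul, bil_smul_left, Finset.mul_sum, mul_add, mul_assoc]

theorem herm_smul_right (c : ℂ) (a b : H3) : herm a (c • b) = conj c * herm a b := by
  simp only [herm, bil, cconj_smul, diag_smul, off_smul, bil_smul_right, Finset.mul_sum, mul_add,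
    mul_left_comm]

end H3

/-! ### Hermitian Jordan triple systems -/

/-- A triple product `{x y z}`, `ℂ`-linear in `x` and `z`, antilinear in `y`; `T x y z` is
`{x y z}` and `T x y` is the linear operator `D(x, y)`. -/
abbrev TripleProduct (V : Type) [AddCommGroup V] [Module ℂ V] :=
  V →ₗ[ℂ] V →ₗ⋆[ℂ] V →ₗ[ℂ] V

namespace TripleProduct

variable {V : Type} [AddCommGroup V] [Module ℂ V] (T : TripleProduct V)

/-- The operator `D(x, y) : z ↦ {x y z}`. -/
def D (x y : V) : V →ₗ[ℂ] V := T x y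

/-- The antilinear operator `Q(x) : y ↦ (1 / 2) {x y x}`. -/
def Q (x : V) : V →ₗ⋆[ℂ] V where
  toFun y := (1 / 2 : ℂ) • T x y x
  map_add' y z := by simp
  map_smul' c y := by
    rw [map_smulₛₗ, LinearMap.smul_apply]
    exact smul_comm _ _ _

/-- The Bergman operator `B(x, y) = I - D(x, y) + Q(x) Q(y)`. -/
def B (x y : V) : V →ₗ[ℂ] V := LinearMap.id - T.D x y + (T.Q x).comp (T.Q y)

/-- `T` makes `V` a Hermitian Jordan triple system: `{x y z}` is symmetric in `x` and `z`, and
the two Jordan identities hold. -/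
structure IsHermitianJTS : Prop where
  symm : ∀ x y z, T x y z = T z y x
  jordan₁ : ∀ x y u, T.D x y (T.Q x u) = T.Q x (T.D y x u)
  jordan₂ : ∀ x y, T.D (T.Q x y) y = T.D x (T.Q y x)

/-- Positivity: if `x ≠ 0` and `x^(3) = c x`, where `x^(3) = (1 / 2) {x x x}`, then `c` is real and
positive. -/
def IsPositive : Prop :=
  ∀ (x : V) (c : ℂ), x ≠ 0 → T.Q x x = c • x → c.im = 0 ∧ 0 < c.re

/-- The trace form `(x, y) ↦ Tr D(x, y)` is Hermitian and positive definite. -/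
def TraceFormPosDef : Prop :=
  (∀ x y, LinearMap.trace ℂ V (T.D y x) = conj (LinearMap.trace ℂ V (T.D x y))) ∧
    ∀ x, x ≠ 0 → 0 < (LinearMap.trace ℂ V (T.D x x)).re

/-- A subspace `I` is an ideal if `{x y z} ∈ I` as soon as one of `x`, `y`, `z` is in `I`. -/
def IsIdeal (I : Submodule ℂ V) : Prop :=
  ∀ u ∈ I, ∀ x y, T u x y ∈ I ∧ T x u y ∈ I ∧ T x y u ∈ I

/-- Simplicity: the product is not zero and there are no ideals except `0` and `V`. -/
def IsSimple : Prop :=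
  (∃ x y z, T x y z ≠ 0) ∧ ∀ I : Submodule ℂ V, T.IsIdeal I → I = ⊥ ∨ I = ⊤

/-- `T.pow x y k` is the power `x^(k+1, y)`: `x^(1, y) = x`,
`x^(k+1, y) = (1 / 2) D(x, y) x^(k, y)`. -/
def pow (x y : V) : ℕ → V
  | 0 => x
  | k + 1 => (1 / 2 : ℂ) • T.D x y (pow x y k)

/-- The rank is `r`, the degree of the generic minimal polynomial: `r` is the largest dimension of
a space spanned by the powers `x^(k, y)`, `k ≥ 1`, for `x`, `y` in `V`. -/
def HasRank (r : ℕ) : Prop :=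
  IsGreatest {d : ℕ | ∃ x y : V, d = Module.finrank ℂ (Submodule.span ℂ (Set.range (T.pow x y)))} r

/-- A tripotent is an element with `x^(3) = x`. -/
def IsTripotent (x : V) : Prop := T.Q x x = x

/-- Two tripotents `x`, `y` are orthogonal if `D(x, y) = 0`. -/
def Orthogonal (x y : V) : Prop := T.D x y = 0

/-- A tripotent is minimal if it is not zero and not the sum of two orthogonal non-zero
tripotents. -/
def IsMinimalTripotent (x : V) : Prop :=
  T.IsTripotent x ∧ x ≠ 0 ∧
    ∀ y z, T.IsTripotent y → T.IsTripotent z → T.Orthogonal y z → x = y + z → y = 0 ∨ z = 0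

/-- A finite sequence of pairwise orthogonal minimal tripotents. -/
def IsOrthogonalSystem {m : ℕ} (e : Fin m → V) : Prop :=
  (∀ i, T.IsMinimalTripotent (e i)) ∧ ∀ i j, i ≠ j → T.Orthogonal (e i) (e j)

/-- A tripotent has rank `k` if it is the sum of `k` pairwise orthogonal minimal tripotents. -/
def IsTripotentOfRank (k : ℕ) (x : V) : Prop :=
  T.IsTripotent x ∧ ∃ e : Fin k → V, T.IsOrthogonalSystem e ∧ x = ∑ i, e i

/-- A frame is a maximal system of pairwise orthogonal minimal tripotents. -/
def IsFrame {m : ℕ} (e : Fin m → V) : Prop :=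
  T.IsOrthogonalSystem e ∧
    ∀ f, T.IsMinimalTripotent f → ¬ ∀ i, T.Orthogonal (e i) f ∧ T.Orthogonal f (e i)

/-- The space `V_ij` of the simultaneous Peirce decomposition relative to `e`, that is
`{z | D(e_k, e_k) z = (δ_ik + δ_jk) z for all k}`. The index `0` of `V_0i`, which belongs to no
element of `e`, is `none`. -/
def peirce {m : ℕ} (e : Fin m → V) (i j : Option (Fin m)) : Submodule ℂ V :=
  ⨅ k : Fin m, LinearMap.ker
    (T.D (e k) (e k) -
      ((if i = some k then 1 else 0) + (if j = some k then 1 else 0) : ℂ) • LinearMap.id)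

/-- The numerical invariants of a simple positive Hermitian Jordan triple system: the rank is `r`;
frames exist, and each frame has `r` elements, `dim V_ij = a` for `1 ≤ i < j ≤ r` and
`dim V_0i = b` for `1 ≤ i ≤ r`; the genus is `g = 2 + a (r - 1) + b`. -/
structure HasInvariants (a b r g : ℕ) : Prop where
  rank : T.HasRank r
  exists_frame : ∃ e : Fin r → V, T.IsFrame e
  length_frame : ∀ (m : ℕ) (e : Fin m → V), T.IsFrame e → m = r
  dim_a : ∀ e : Fin r → V, T.IsFrame e → ∀ i j : Fin r, i < j →
    Module.finrank ℂ (T.peirce e (some i) (some j)) = a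
  dim_b : ∀ e : Fin r → V, T.IsFrame e → ∀ i : Fin r,
    Module.finrank ℂ (T.peirce e none (some i)) = b
  genus : (g : ℤ) = 2 + a * (r - 1) + b

/-- The triple product of a subsystem, that is, of a subspace closed under the triple product. -/
def restrict (W : Submodule ℂ V) (h : ∀ x ∈ W, ∀ y ∈ W, ∀ z ∈ W, T x y z ∈ W) :
    TripleProduct W where
  toFun x :=
    { toFun := fun y => (T x y).restrict fun z hz => h x x.2 y y.2 z hz
      map_add' := fun y y' => by ext z; simp
      map_smul' := fun c y => by ext z; simp }
  map_add' x x' := by ext y z; simp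
  map_smul' c x := by ext y z; simp

end TripleProduct

/-! ### The exceptional triple systems of dimension 27 and 16 -/

/-- The triple product `{x y z} = (x | y) z + (z | y) x - (x × z) × ȳ` on `H₃(𝕆)`. -/
def H3.triple : TripleProduct H3 where
  toFun x :=
    { toFun := fun y =>
        { toFun := fun z => H3.herm x y • z + H3.herm z y • x - H3.frd (H3.frd x z) (H3.cconj y)
          map_add' := fun z z' => by
            simp only [H3.herm_add_left, H3.frd_add_left, H3.frd_add_right, smul_add, add_smul]
            abel
          map_smul' := fun c z => by
            simp only [H3.herm_smul_left, H3.frd_smul_left, H3.frd_smul_right, smul_add, smul_sub,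
              mul_smul, RingHom.id_apply]
            rw [smul_comm c (H3.herm x y)] }
      map_add' := fun y y' => by
        ext1 z
        simp only [H3.herm_add_right, H3.cconj_add, H3.frd_add_right, add_smul,
          LinearMap.coe_mk, AddHom.coe_mk, LinearMap.add_apply]
        abel
      map_smul' := fun c y => by
        ext1 z
        simp only [H3.herm_smul_right, H3.cconj_smul, H3.frd_smul_right, smul_add, smul_sub,
          mul_smul, LinearMap.coe_mk, AddHom.coe_mk, LinearMap.smul_apply] }
  map_add' x x' := by
    ext1 y; ext1 z
    simp only [H3.herm_add_left, H3.frd_add_left, add_smul, smul_add,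
      LinearMap.coe_mk, AddHom.coe_mk, LinearMap.add_apply]
    abel
  map_smul' c x := by
    ext1 y; ext1 z
    simp only [H3.herm_smul_left, H3.frd_smul_left, smul_add, smul_sub, mul_smul,
      LinearMap.coe_mk, AddHom.coe_mk, LinearMap.smul_apply, RingHom.id_apply]
    rw [smul_comm (H3.herm z y) c]

/-- The subspace `W = 𝓕₂ ⊕ 𝓕₃` of `H₃(𝕆)`. -/
def W : Submodule ℂ H3 := LinearMap.range (H3.F 1) ⊔ LinearMap.range (H3.F 2)

theorem mem_W {x : H3} : x ∈ W ↔ x.diag = 0 ∧ x.off 0 = 0 := by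
  constructor
  · intro hx
    obtain ⟨_, ⟨p, rfl⟩, _, ⟨q, rfl⟩, rfl⟩ := Submodule.mem_sup.1 hx
    refine ⟨?_, ?_⟩
    · funext i; simp [H3.F]
    · simp [H3.F]
  · rintro ⟨h₁, h₂⟩
    refine Submodule.mem_sup.2 ⟨H3.F 1 (x.off 1), ⟨_, rfl⟩, H3.F 2 (x.off 2), ⟨_, rfl⟩, ?_⟩
    ext1 <;> funext i
    · simp [H3.F, h₁]
    · fin_cases i <;> simp [H3.F, h₂]

theorem W_closed : ∀ x ∈ W, ∀ y ∈ W, ∀ z ∈ W, H3.triple x y z ∈ W := by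
  intro x hx y hy z hz
  rw [mem_W] at hx hy hz
  obtain ⟨hx₁, hx₂⟩ := hx
  obtain ⟨hy₁, hy₂⟩ := hy
  obtain ⟨hz₁, hz₂⟩ := hz
  have key : H3.frd (H3.frd x z) (H3.cconj y) ∈ W := by
    rw [mem_W]
    constructor
    · funext i
      fin_cases i <;>
        simp [H3.diag_frd, H3.off_frd, H3.cconj, hx₁, hx₂, hy₁, hy₂, hz₁, hz₂]
    · simp [H3.diag_frd, H3.off_frd, H3.cconj, hx₁, hx₂, hy₁, hy₂, hz₁, hz₂]
  have hx : x ∈ W := mem_W.2 ⟨hx₁, hx₂⟩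
  have hz : z ∈ W := mem_W.2 ⟨hz₁, hz₂⟩
  exact W.sub_mem (W.add_mem (W.smul_mem _ hz) (W.smul_mem _ hx)) key

/-- The triple product of the subsystem `W`. -/
def tripleW : TripleProduct W := H3.triple.restrict W W_closed

end ExceptionalJTS

end

/-!
In the coordinates `(x₂, x₃)` the product `{x ȳ z}` is the triple product of a Jordan pair on
`𝕆 ⊕ 𝕆`, which is defined over any commutative ring. Over a field, automorphisms of this pair
move every `x` to a pair whose first component is zero. For such `x` the Jordan identities and the
formula for the Bergman determinant follow from the composition rules of the octonions.

The form `(x | y)` is positive definite, `D(y, x)` is adjoint to `D(x, y)`, and each `x` satisfies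
`x^(5) = (x | x) x^(3) - (x^# | x^#) x`. Applied to a tripotent `x ≠ 0`, this equation leaves only
the values `(x | x) = 1` and `(x | x) = 2`; applied to `e + t u` with a tripotent `e` and
`D(e, e) u = 0` for all real `t`, it shows that `u` is zero or proportional to a tripotent of rank
one. The Peirce spaces have the dimensions that result from the traces of their projections. An
ideal that misses a tripotent `c` of rank one lies in the kernel of `D(c, c)`, of dimension `5`,
whereas an ideal that contains `c` contains the image of `D(c, c)`, of dimension `11`.
-/

open scoped ComplexConjugate Quaternion

noncomputable section

namespace ExceptionalJTS

/-! ### Traces and determinants -/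

section LinearAlgebra

open LinearMap Polynomial

variable {R M N : Type*} [CommRing R] [AddCommGroup M] [Module R M] [AddCommGroup N] [Module R N]

theorem trace_prod_eq_add [Module.Free R M] [Module.Finite R M] [Module.Free R N]
    [Module.Finite R N] (f : M × N →ₗ[R] M × N) :
    trace R _ f =
      trace R M (fst R M N ∘ₗ f ∘ₗ inl R M N) + trace R N (snd R M N ∘ₗ f ∘ₗ inr R M N) := by
  rw [trace_comp_comm' (f ∘ₗ inl R M N), trace_comp_comm' (f ∘ₗ inr R M N), ← map_add]
  congr 1
  refine LinearMap.ext fun x => ?_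
  simp [← map_add]

theorem det_prod_eq_mul [Module.Free R M] [Module.Finite R M] [Module.Free R N]
    [Module.Finite R N] (f : M × N →ₗ[R] M × N) (hf : ∀ v, (f (0, v)).1 = 0) :
    LinearMap.det f =
      LinearMap.det (fst R M N ∘ₗ f ∘ₗ inl R M N) *
        LinearMap.det (snd R M N ∘ₗ f ∘ₗ inr R M N) := by
  classical
  let b := Module.Free.chooseBasis R M
  let b' := Module.Free.chooseBasis R N
  have h : toMatrix (b.prod b') (b.prod b') f = Matrix.fromBlocks
      (toMatrix b b (fst R M N ∘ₗ f ∘ₗ inl R M N)) 0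
      (toMatrix b b' (snd R M N ∘ₗ f ∘ₗ inl R M N))
      (toMatrix b' b' (snd R M N ∘ₗ f ∘ₗ inr R M N)) := by
    ext (i | i) (j | j) <;> simp [toMatrix_apply, hf]
  rw [← det_toMatrix (b.prod b'), h, Matrix.det_fromBlocks_zero₁₂, det_toMatrix, det_toMatrix]

theorem det_smul_id_add_smulRight_add_smulRight {ι : Type*} [Fintype ι] {m : ℕ}
    (b : Module.Basis ι R M) (hm : Fintype.card ι = m + 2) (t : R) (φ ψ : M →ₗ[R] R) (u v : M) :
    LinearMap.det (t • LinearMap.id + φ.smulRight u + ψ.smulRight v) =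
      t ^ m * ((t + φ u) * (t + ψ v) - φ v * ψ u) := by
  classical
  let A : Matrix ι (Fin 2) R := Matrix.of fun i => ![-b.repr u i, -b.repr v i]
  let B : Matrix (Fin 2) ι R := Matrix.of ![fun j => φ (b j), fun j => ψ (b j)]
  have sum_apply_mul_repr (χ : M →ₗ[R] R) (w : M) : ∑ i, χ (b i) * b.repr w i = χ w := by
    conv_rhs => rw [← b.sum_repr w]
    simp only [map_sum, map_smul, smul_eq_mul, mul_comm]
  have hAB : toMatrix b b (t • LinearMap.id + φ.smulRight u + ψ.smulRight v) =
      Matrix.scalar ι t - A * B := by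
    ext i j
    simp [A, B, toMatrix_apply, Matrix.mul_apply, Fin.sum_univ_two, Matrix.diagonal_apply,
      Finsupp.single_apply, eq_comm (a := i)]
    ring
  have hBA : B * A = !![-φ u, -φ v; -ψ u, -ψ v] := by
    ext i j
    fin_cases i <;> fin_cases j <;> simp [A, B, Matrix.mul_apply, sum_apply_mul_repr]
  rw [← det_toMatrix b, hAB, ← Matrix.eval_charpoly,
    Matrix.charpoly_mul_comm_of_le _ _ (by simp [hm]), hBA, eval_mul, Matrix.eval_charpoly,
    Matrix.det_fin_two]
  simp [hm]

variable {n : Type*} [Fintype n] [DecidableEq n] {A : Matrix n n R} {s m : R}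

theorem charpoly_sq_of_mul_transpose (hs : A + A.transpose = s • 1)
    (hm : A * A.transpose = m • 1) :
    A.charpoly ^ 2 = (X ^ 2 - C s * X + C m) ^ Fintype.card n := by
  have hs' : C.mapMatrix A + C.mapMatrix A.transpose = C s • 1 := by
    rw [← map_add, hs, Matrix.smul_one_eq_diagonal, Matrix.smul_one_eq_diagonal]
    simp [Matrix.diagonal_map]
  have hm' : C.mapMatrix A * C.mapMatrix A.transpose = C m • 1 := by
    rw [← map_mul, hm, Matrix.smul_one_eq_diagonal, Matrix.smul_one_eq_diagonal]
    simp [Matrix.diagonal_map]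
  have key : A.charmatrix * A.transpose.charmatrix =
      (X ^ 2 - C s * X + C m) • (1 : Matrix n n R[X]) := by
    calc _ = (X ^ 2 : R[X]) • 1 - (X : R[X]) • (C.mapMatrix A + C.mapMatrix A.transpose)
          + C.mapMatrix A * C.mapMatrix A.transpose := by
          simp only [Matrix.charmatrix, Matrix.scalar_apply, ← Matrix.smul_one_eq_diagonal, sub_mul,
            mul_sub, smul_mul_assoc, mul_smul_comm, one_mul, mul_one]
          module
      _ = _ := by
          rw [hs', hm']
          module
  calc A.charpoly ^ 2 = A.charpoly * A.transpose.charpoly := by rw [Matrix.charpoly_transpose, sq]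
    _ = (A.charmatrix * A.transpose.charmatrix).det := (Matrix.det_mul _ _).symm
    _ = _ := by rw [key, Matrix.det_smul, Matrix.det_one, mul_one]

theorem charpoly_of_mul_transpose [IsDomain R] {k : ℕ} (hk : Fintype.card n = 2 * k)
    (hs : A + A.transpose = s • 1) (hm : A * A.transpose = m • 1) :
    A.charpoly = (X ^ 2 - C s * X + C m) ^ k := by
  have hmonic : (X ^ 2 - C s * X + C m : R[X]).Monic := by monicity!
  refine (sq_eq_sq_iff_eq_or_eq_neg.1 ?_).elim id fun h => ?_
  · rw [charpoly_sq_of_mul_transpose hs hm, hk, pow_mul', pow_right_comm]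
  · have hlead := A.charpoly_monic.leadingCoeff
    rw [h, leadingCoeff_neg, (hmonic.pow k).leadingCoeff] at hlead
    rw [h, neg_eq_neg_one_mul, ← C_1, ← C_neg, hlead, C_1, one_mul]

theorem det_one_sub_of_mul_transpose [IsDomain R] {k : ℕ} (hk : Fintype.card n = 2 * k)
    (hs : A + A.transpose = s • 1) (hm : A * A.transpose = m • 1) :
    (1 - A).det = (1 - s + m) ^ k := by
  simpa [Matrix.eval_charpoly] using
    congrArg (Polynomial.eval 1) (charpoly_of_mul_transpose hk hs hm)

end LinearAlgebra

/-! ### Octonions -/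

namespace Octonion

section CommRing

variable {R : Type} [CommRing R]

instance : NonUnitalNonAssocRing (Octonion R) where
  left_distrib := oct_mul_add
  right_distrib := oct_add_mul
  zero_mul := oct_zero_mul
  mul_zero := oct_mul_zero

instance : IsScalarTower R (Octonion R) (Octonion R) := ⟨oct_smul_mul⟩

instance : SMulCommClass R (Octonion R) (Octonion R) := ⟨fun c x y => (oct_mul_smul c x y).symm⟩

theorem cayley_sub (x y : Octonion R) : cayley (x - y) = cayley x - cayley y := by
  ext <;> simp [cayley] <;> ring

theorem cayley_mul (x y : Octonion R) : cayley (x * y) = cayley y * cayley x := by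
  ext <;> simp [cayley, mul_def]

theorem cayley_mul_mul_self (x y : Octonion R) : cayley x * (x * y) = n x • y := by
  ext <;> simp [cayley, mul_def, n, Quaternion.normSq_def'] <;> ring

theorem mul_mul_cayley_self (x y : Octonion R) : (x * y) * cayley y = n y • x := by
  ext <;> simp [cayley, mul_def, n, Quaternion.normSq_def'] <;> ring

@[simp] theorem n_zero : n (0 : Octonion R) = 0 := by simp [n]

@[simp] theorem n_cayley (x : Octonion R) : n (cayley x) = n x := by
  simp [n, cayley, Quaternion.normSq_def']

@[simp] theorem n_smul (c : R) (x : Octonion R) : n (c • x) = c ^ 2 * n x := by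
  simp [n, Quaternion.normSq_def']; ring

theorem n_mul (x y : Octonion R) : n (x * y) = n x * n y := by
  simp [n, mul_def, Quaternion.normSq_def']; ring

theorem n_add (x y : Octonion R) : n (x + y) = n x + n y + bil x y := by
  simp [bil]

theorem bil_comm (x y : Octonion R) : bil x y = bil y x := by
  simp [bil_eq]; ring

theorem bil_self (x : Octonion R) : bil x x = 2 * n x := by
  simp [bil_eq, n, Quaternion.normSq_def']; ring

@[simp] theorem bil_neg_right (x y : Octonion R) : bil x (-y) = -bil x y := by
  simp [bil_eq]; ring

theorem bil_cayley (x y : Octonion R) : bil (cayley x) y = bil x (cayley y) := by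
  simp [bil_eq, cayley]

theorem bil_mul_left (x y z : Octonion R) : bil (x * y) z = bil y (cayley x * z) := by
  simp [bil_eq, cayley, mul_def]; ring

theorem bil_mul_right (x y z : Octonion R) : bil (x * y) z = bil x (z * cayley y) := by
  simp [bil_eq, cayley, mul_def]; ring

theorem mul_cayley_mul_self (x y : Octonion R) : x * (cayley x * y) = n x • y := by
  simpa using cayley_mul_mul_self (cayley x) y

theorem mul_cayley_mul (x y : Octonion R) : (x * cayley y) * y = n y • x := by
  simpa using mul_mul_cayley_self x (cayley y)

theorem cayley_mul_mul_add (x y z : Octonion R) :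
    cayley x * (z * y) + cayley z * (x * y) = bil x z • y := by
  have h := cayley_mul_mul_self (x + z) y
  simp only [n_add, add_mul, mul_add, cayley_add, add_smul, cayley_mul_mul_self] at h
  linear_combination (norm := module) h

theorem mul_cayley_mul_add (x y z : Octonion R) :
    x * (cayley z * y) + z * (cayley x * y) = bil x z • y := by
  simpa [bil_cayley] using cayley_mul_mul_add (cayley x) y (cayley z)

theorem mul_mul_cayley_add (x y z : Octonion R) :
    (x * y) * cayley z + (x * z) * cayley y = bil y z • x := by
  have h := mul_mul_cayley_self x (y + z)
  simp only [n_add, add_mul, mul_add, cayley_add, add_smul, mul_mul_cayley_self] at h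
  linear_combination (norm := module) h

theorem mul_cayley_mul_add' (x y z : Octonion R) :
    (x * cayley y) * z + (x * cayley z) * y = bil y z • x := by
  simpa [bil_cayley] using mul_mul_cayley_add x (cayley y) (cayley z)

theorem bil_mul_mul_add (p x z w : Octonion R) :
    bil (p * x) (z * w) + bil (z * x) (p * w) = bil p z * bil x w := by
  have h := n_mul (p + z) (x + w)
  have hx := n_mul (p + z) x
  have hw := n_mul (p + z) w
  have hp := n_mul p (x + w)
  have hz := n_mul z (x + w)
  simp only [add_mul, mul_add, n_add, n_mul, bil_add_left, bil_add_right] at h hx hw hp hz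
  linear_combination h - hx - hw - hp - hz

/-- The bilinear form of the norm as a bundled bilinear map. -/
def bilForm : Octonion R →ₗ[R] Octonion R →ₗ[R] R :=
  .mk₂ R bil bil_add_left bil_smul_left bil_add_right bil_smul_right

@[simp] theorem bilForm_apply (x y : Octonion R) : bilForm x y = bil x y := rfl

/-- The coordinates of an octonion. -/
def coords (R : Type) [CommRing R] : Octonion R ≃ₗ[R] (Fin 8 → R) where
  toFun x := ![x.fst.re, x.fst.imI, x.fst.imJ, x.fst.imK,
    x.snd.re, x.snd.imI, x.snd.imJ, x.snd.imK]
  map_add' x y := by ext i; fin_cases i <;> rfl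
  map_smul' c x := by ext i; fin_cases i <;> rfl
  invFun v := ⟨⟨v 0, v 1, v 2, v 3⟩, ⟨v 4, v 5, v 6, v 7⟩⟩
  left_inv _ := rfl
  right_inv v := by ext i; fin_cases i <;> rfl

theorem coords_apply (x : Octonion R) : coords R x = ![x.fst.re, x.fst.imI, x.fst.imJ, x.fst.imK,
    x.snd.re, x.snd.imI, x.snd.imJ, x.snd.imK] := rfl

theorem coords_symm_apply (v : Fin 8 → R) :
    (coords R).symm v = ⟨⟨v 0, v 1, v 2, v 3⟩, ⟨v 4, v 5, v 6, v 7⟩⟩ := rfl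

/-- The basis of eight orthogonal units. -/
def basis (R : Type) [CommRing R] : Module.Basis (Fin 8) R (Octonion R) :=
  .ofEquivFun (coords R)

instance : Module.Free R (Octonion R) := .of_basis (basis R)

instance : Module.Finite R (Octonion R) := .of_basis (basis R)

theorem finrank_octonion [Nontrivial R] : Module.finrank R (Octonion R) = 8 := by
  simpa using Module.finrank_eq_card_basis (basis R)

theorem bil_basis (x : Octonion R) (i : Fin 8) :
    bil (basis R i) x = 2 * (basis R).repr x i := by
  rw [bil_eq, basis, Module.Basis.coe_ofEquivFun]
  fin_cases i <;> simp [coords_apply, coords_symm_apply]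

theorem bil_eq_sum (x y : Octonion R) :
    bil x y = 2 * ∑ i, (basis R).repr x i * (basis R).repr y i := by
  simp [Fin.sum_univ_eight, basis, coords_apply, bil_eq]

open LinearMap

/-- The operator `x ↦ (x b) c~`. -/
def rightOp (b c : Octonion R) : Octonion R →ₗ[R] Octonion R :=
  mulRight R (cayley c) ∘ₗ mulRight R b

/-- The operator `x ↦ c~ (b x)`. -/
def leftOp (b c : Octonion R) : Octonion R →ₗ[R] Octonion R :=
  mulLeft R (cayley c) ∘ₗ mulLeft R b

@[simp] theorem rightOp_apply (b c x : Octonion R) : rightOp b c x = (x * b) * cayley c := rfl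

@[simp] theorem leftOp_apply (b c x : Octonion R) : leftOp b c x = cayley c * (b * x) := rfl

theorem bil_rightOp (b c x y : Octonion R) : bil (rightOp b c x) y = bil x (rightOp c b y) := by
  simp [bil_mul_right]

theorem bil_leftOp (b c x y : Octonion R) : bil (leftOp b c x) y = bil x (leftOp c b y) := by
  simp [bil_mul_left]

theorem rightOp_add_rightOp (b c : Octonion R) :
    rightOp b c + rightOp c b = bil b c • LinearMap.id :=
  LinearMap.ext fun x => mul_mul_cayley_add x b c

theorem leftOp_add_leftOp (b c : Octonion R) :
    leftOp b c + leftOp c b = bil b c • LinearMap.id :=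
  LinearMap.ext fun x => (cayley_mul_mul_add c x b).trans (by rw [bil_comm]; rfl)

theorem rightOp_comp_rightOp (b c : Octonion R) :
    rightOp b c ∘ₗ rightOp c b = (n b * n c) • LinearMap.id := by
  ext1 x
  simp [mul_cayley_mul, mul_mul_cayley_self, smul_mul_assoc, smul_smul]

theorem det_octonion_bergman (b d : Octonion R) :
    LinearMap.det ((1 - bil b d + n b * n d) • LinearMap.id
      + ((bil b d - 1) • bilForm d - n d • bilForm b).smulRight b
      + (bilForm b - n b • bilForm d).smulRight d) = (1 - bil b d + n b * n d) ^ 8 := by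
  rw [det_smul_id_add_smulRight_add_smulRight (basis R) (m := 6) rfl]
  simp only [LinearMap.sub_apply, LinearMap.smul_apply, bilForm_apply, smul_eq_mul, bil_self,
    bil_comm d b]
  ring

end CommRing

section IsDomain

open LinearMap

variable {R : Type} [CommRing R] [IsDomain R] [NeZero (2 : R)]

theorem eq_of_bil_eq {x y : Octonion R} (h : ∀ z, bil x z = bil y z) : x = y := by
  refine (basis R).ext_elem fun i => mul_left_cancel₀ (two_ne_zero : (2 : R) ≠ 0) ?_
  rw [← bil_basis, ← bil_basis, bil_comm, h, bil_comm]

theorem middle_moufang (p x y : Octonion R) :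
    (p * x) * (y * p) = bil p (cayley (x * y)) • p - n p • cayley (x * y) := by
  refine eq_of_bil_eq fun z => ?_
  have h := bil_mul_mul_add p x z (cayley p * cayley y)
  have hp : bil x (cayley p * cayley y) = bil p (cayley (x * y)) := by
    rw [bil_comm, bil_mul_left, cayley_cayley, bil_comm, bil_mul_right, cayley_mul]
  have hz : bil (z * x) (cayley y) = bil (cayley (x * y)) z := by
    rw [bil_mul_right, bil_comm, cayley_mul]
  rw [mul_cayley_mul_self, bil_smul_right, hp, hz] at h
  rw [bil_mul_right, cayley_mul y p, sub_eq_add_neg, ← neg_smul, bil_add_left, bil_smul_left,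
    bil_smul_left]
  linear_combination h

theorem toMatrix_transpose_of_adjoint {f g : Octonion R →ₗ[R] Octonion R}
    (h : ∀ x y, bil (f x) y = bil x (g y)) :
    (toMatrix (basis R) (basis R) f).transpose = toMatrix (basis R) (basis R) g := by
  ext i j
  rw [Matrix.transpose_apply, toMatrix_apply, toMatrix_apply]
  refine mul_left_cancel₀ (two_ne_zero : (2 : R) ≠ 0) ?_
  rw [← bil_basis, ← bil_basis, bil_comm, h]

theorem trace_of_adjoint {f g : Octonion R →ₗ[R] Octonion R} {s : R}
    (h : ∀ x y, bil (f x) y = bil x (g y)) (hs : f + g = s • LinearMap.id) :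
    trace R _ f = 4 * s := by
  have hg : trace R _ g = trace R _ f := by
    rw [trace_eq_matrix_trace R (basis R) f, trace_eq_matrix_trace R (basis R) g,
      ← toMatrix_transpose_of_adjoint h, Matrix.trace_transpose]
  have hsum := congrArg (trace R _) hs
  rw [map_add, hg, map_smul, trace_id, finrank_octonion, smul_eq_mul] at hsum
  refine mul_left_cancel₀ (two_ne_zero : (2 : R) ≠ 0) ?_
  push_cast at hsum
  linear_combination hsum

theorem det_one_sub_of_adjoint {f g : Octonion R →ₗ[R] Octonion R} {s m : R}
    (h : ∀ x y, bil (f x) y = bil x (g y)) (hs : f + g = s • LinearMap.id)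
    (hm : f ∘ₗ g = m • LinearMap.id) :
    LinearMap.det (1 - f) = (1 - s + m) ^ 4 := by
  have hM := det_one_sub_of_mul_transpose (A := toMatrix (basis R) (basis R) f) (s := s) (m := m)
    (k := 4) (by simp)
    (by rw [toMatrix_transpose_of_adjoint h, ← map_add, hs, map_smul, toMatrix_id])
    (by rw [toMatrix_transpose_of_adjoint h, ← toMatrix_comp, hm, map_smul, toMatrix_id])
  rw [← hM, ← det_toMatrix (basis R), map_sub, toMatrix_one]

theorem trace_rightOp (b c : Octonion R) : trace R _ (rightOp b c) = 4 * bil b c :=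
  trace_of_adjoint (bil_rightOp b c) (rightOp_add_rightOp b c)

theorem trace_leftOp (b c : Octonion R) : trace R _ (leftOp b c) = 4 * bil b c :=
  trace_of_adjoint (bil_leftOp b c) (leftOp_add_leftOp b c)

theorem det_one_sub_rightOp (b c : Octonion R) :
    LinearMap.det (1 - rightOp b c) = (1 - bil b c + n b * n c) ^ 4 :=
  det_one_sub_of_adjoint (bil_rightOp b c) (rightOp_add_rightOp b c) (rightOp_comp_rightOp b c)

end IsDomain

end Octonion

open Octonion

/-! ### The Jordan pair of pairs of octonions -/

/-- Pairs of octonions. -/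
abbrev OctPair (R : Type) [CommRing R] := Octonion R × Octonion R

/-- The space in which the adjoints of pairs of octonions live; it carries the ten-dimensional
quadratic form `sharpNorm`. -/
abbrev OctSharp (R : Type) [CommRing R] := R × R × Octonion R

namespace OctPair

section CommRing

variable {R : Type} [CommRing R]

/-- The bilinear form of pairs. -/
def form : OctPair R →ₗ[R] OctPair R →ₗ[R] R :=
  .mk₂ R (fun x y => bil x.1 y.1 + bil x.2 y.2)
    (fun x y z => by simp [bil_add_left]; ring) (fun c x y => by simp [bil_smul_left]; ring)
    (fun x y z => by simp [bil_add_right]; ring) (fun c x y => by simp [bil_smul_right]; ring)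

theorem form_apply (x y : OctPair R) : form x y = bil x.1 y.1 + bil x.2 y.2 := rfl

/-- The bilinear form on the space of adjoints. -/
def sharpForm : OctSharp R →ₗ[R] OctSharp R →ₗ[R] R :=
  .mk₂ R (fun s t => s.1 * t.1 + s.2.1 * t.2.1 + bil s.2.2 t.2.2)
    (fun x y z => by simp [bil_add_left]; ring) (fun c x y => by simp [bil_smul_left]; ring)
    (fun x y z => by simp [bil_add_right]; ring) (fun c x y => by simp [bil_smul_right]; ring)

theorem sharpForm_apply (s t : OctSharp R) :
    sharpForm s t = s.1 * t.1 + s.2.1 * t.2.1 + bil s.2.2 t.2.2 := rfl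

/-- The adjoint of a pair. -/
def sharp (x : OctPair R) : OctSharp R := (n x.1, n x.2, x.1 * x.2)

/-- The polarisation of the adjoint. -/
def cross : OctPair R →ₗ[R] OctPair R →ₗ[R] OctSharp R :=
  .mk₂ R (fun x y => (bil x.1 y.1, bil x.2 y.2, x.1 * y.2 + y.1 * x.2))
    (fun x y z => by simp [bil_add_left, add_mul, mul_add]; abel)
    (fun c x y => by simp [bil_smul_left, smul_mul_assoc, mul_smul_comm])
    (fun x y z => by simp [bil_add_right, add_mul, mul_add]; abel)
    (fun c x y => by simp [bil_smul_right, smul_mul_assoc, mul_smul_comm])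

theorem cross_apply (x y : OctPair R) :
    cross x y = (bil x.1 y.1, bil x.2 y.2, x.1 * y.2 + y.1 * x.2) := rfl

/-- The action of the space of adjoints on pairs; it is the Clifford action of the quadratic space
`OctSharp R` between its half-spin modules, both of which are identified with `OctPair R`. -/
def act : OctSharp R →ₗ[R] OctPair R →ₗ[R] OctPair R :=
  .mk₂ R (fun s y => (s.1 • y.1 + s.2.2 * cayley y.2, s.2.1 • y.2 + cayley y.1 * s.2.2))
    (fun x y z => by ext1 <;> simp only [Prod.fst_add, Prod.snd_add, add_mul, mul_add] <;> module)
    (fun c x y => by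
      ext1 <;> simp [mul_smul, smul_mul_assoc, mul_smul_comm])
    (fun x y z => by
      ext1 <;> simp only [Prod.fst_add, Prod.snd_add, cayley_add, add_mul, mul_add] <;> module)
    (fun c x y => by
      ext1 <;> simp [cayley_smul, smul_mul_assoc, mul_smul_comm, smul_comm c])

theorem act_apply (s : OctSharp R) (y : OctPair R) :
    act s y = (s.1 • y.1 + s.2.2 * cayley y.2, s.2.1 • y.2 + cayley y.1 * s.2.2) := rfl

/-- The quadratic operators of the Jordan pair; `quad x y` is `Q(x) ȳ` in coordinates. -/
def quad (x : OctPair R) : OctPair R →ₗ[R] OctPair R := (form x).smulRight x - act (sharp x)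

theorem quad_apply (x y : OctPair R) : quad x y = form x y • x - act (sharp x) y := rfl

/-- The triple product of the Jordan pair; `trip x y z` is `{x ȳ z}` in coordinates. -/
def trip (x y : OctPair R) : OctPair R →ₗ[R] OctPair R :=
  form x y • LinearMap.id + (form.flip y).smulRight x - act.flip y ∘ₗ cross x

theorem trip_apply (x y z : OctPair R) :
    trip x y z = form x y • z + form z y • x - act (cross x z) y := rfl

/-- The Bergman operators of the Jordan pair. -/
def bergman (x y : OctPair R) : OctPair R →ₗ[R] OctPair R :=
  LinearMap.id - trip x y + quad x ∘ₗ quad y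

theorem bergman_apply (x y z : OctPair R) :
    bergman x y z = z - trip x y z + quad x (quad y z) := rfl

theorem form_comm (x y : OctPair R) : form x y = form y x := by
  simp [form_apply, bil_comm]

theorem sharpForm_comm (s t : OctSharp R) : sharpForm s t = sharpForm t s := by
  simp [sharpForm_apply, bil_comm, mul_comm]

theorem sharp_add (x y : OctPair R) : sharp (x + y) = sharp x + sharp y + cross x y := by
  simp [sharp, cross_apply, n_add, add_mul, mul_add]
  abel

theorem sharp_smul (c : R) (x : OctPair R) : sharp (c • x) = c ^ 2 • sharp x := by
  simp [sharp, n_smul, smul_mul_smul_comm, sq]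

theorem cross_comm (x y : OctPair R) : cross x y = cross y x := by
  simp [cross_apply, bil_comm, add_comm]

theorem cross_self (x : OctPair R) : cross x x = (2 : R) • sharp x := by
  simp [cross_apply, sharp, bil_self, two_smul, two_mul]

theorem form_act (s : OctSharp R) (x y : OctPair R) :
    form (act s x) y = sharpForm s (cross x y) := by
  simp only [form_apply, act_apply, sharpForm_apply, cross_apply, bil_add_left, bil_smul_left,
    bil_add_right]
  rw [bil_mul_right, cayley_cayley, bil_mul_left, cayley_cayley]
  ring

theorem quad_fst (x y : OctPair R) : (quad x y).1 =
    bil x.1 y.1 • x.1 - n x.1 • y.1 + (x.1 * y.2) * cayley x.2 := by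
  have h := mul_mul_cayley_add x.1 x.2 y.2
  simp only [quad_apply, form_apply, act_apply, sharp, Prod.fst_sub, Prod.smul_fst]
  linear_combination (norm := module) -h

theorem quad_snd (x y : OctPair R) : (quad x y).2 =
    bil x.2 y.2 • x.2 - n x.2 • y.2 + cayley x.1 * (y.1 * x.2) := by
  have h := cayley_mul_mul_add x.1 x.2 y.1
  simp only [quad_apply, form_apply, act_apply, sharp, Prod.snd_sub, Prod.smul_snd]
  linear_combination (norm := module) -h

theorem trip_fst (x y z : OctPair R) : (trip x y z).1 =
    bil x.1 y.1 • z.1 + bil z.1 y.1 • x.1 - bil x.1 z.1 • y.1 + (x.1 * y.2) * cayley z.2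
      + (z.1 * y.2) * cayley x.2 := by
  have h := mul_mul_cayley_add x.1 z.2 y.2
  have h' := mul_mul_cayley_add z.1 x.2 y.2
  simp only [trip_apply, form_apply, act_apply, cross_apply, Prod.fst_sub, Prod.fst_add,
    Prod.smul_fst, add_mul]
  linear_combination (norm := module) -h - h'

theorem trip_snd (x y z : OctPair R) : (trip x y z).2 =
    bil x.2 y.2 • z.2 + bil z.2 y.2 • x.2 - bil x.2 z.2 • y.2 + cayley x.1 * (y.1 * z.2)
      + cayley z.1 * (y.1 * x.2) := by
  have h := cayley_mul_mul_add x.1 z.2 y.1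
  have h' := cayley_mul_mul_add z.1 x.2 y.1
  simp only [trip_apply, form_apply, act_apply, cross_apply, Prod.snd_sub, Prod.snd_add,
    Prod.smul_snd, mul_add]
  linear_combination (norm := module) -h - h'

theorem trip_eq_quad_sub (x y z : OctPair R) :
    trip x y z = quad (x + z) y - quad x y - quad z y := by
  simp only [trip_apply, quad_apply, sharp_add, map_add, LinearMap.add_apply]
  module

theorem trip_comm (x y z : OctPair R) : trip x y z = trip z y x := by
  simp only [trip_apply, cross_comm x z]
  abel

theorem trip_self (x y : OctPair R) : trip x y x = (2 : R) • quad x y := by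
  simp only [trip_apply, quad_apply, cross_self, map_smul, LinearMap.smul_apply]
  module

theorem form_trip (x y z w : OctPair R) : form (trip x y z) w = form z (trip y x w) := by
  simp only [trip_apply, map_add, map_sub, map_smul, LinearMap.add_apply, LinearMap.sub_apply,
    LinearMap.smul_apply, smul_eq_mul]
  rw [form_act, form_comm z (act _ _), form_act, sharpForm_comm, cross_comm x z, form_comm y x,
    form_comm x w]
  ring

/-! ### Automorphisms -/

/-- Automorphisms of the Jordan pair: pairs of linear automorphisms of the two copies of
`OctPair R` compatible with all operations. -/
structure IsAutomorphism (g g' : OctPair R ≃ₗ[R] OctPair R) : Prop where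
  map_quad : ∀ x y, g (quad x y) = quad (g x) (g' y)
  map_quad' : ∀ x y, g' (quad y x) = quad (g' y) (g x)
  form : ∀ x y, form (g x) (g' y) = form x y
  sharpForm : ∀ x y, sharpForm (sharp (g x)) (sharp (g' y)) = sharpForm (sharp x) (sharp y)

namespace IsAutomorphism

variable {g g' : OctPair R ≃ₗ[R] OctPair R}

theorem trans {k k' : OctPair R ≃ₗ[R] OctPair R} (hg : IsAutomorphism g g')
    (hk : IsAutomorphism k k') : IsAutomorphism (g ≪≫ₗ k) (g' ≪≫ₗ k') where
  map_quad x y := by simp [hg.map_quad, hk.map_quad]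
  map_quad' x y := by simp [hg.map_quad', hk.map_quad']
  form x y := by simp [hg.form, hk.form]
  sharpForm x y := by simp [hg.sharpForm, hk.sharpForm]

theorem symm (hg : IsAutomorphism g g') : IsAutomorphism g' g where
  map_quad x y := hg.map_quad' y x
  map_quad' x y := hg.map_quad y x
  form x y := by rw [form_comm, hg.form, form_comm]
  sharpForm x y := by rw [sharpForm_comm, hg.sharpForm, sharpForm_comm]

theorem map_trip (hg : IsAutomorphism g g') (x y z : OctPair R) :
    g (trip x y z) = trip (g x) (g' y) (g z) := by
  simp only [trip_eq_quad_sub, map_sub, hg.map_quad, map_add]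

end IsAutomorphism

/-- The transvection `(a, b) ↦ (a + w b~, b)`. -/
def transvection (w : Octonion R) : OctPair R ≃ₗ[R] OctPair R where
  toFun x := (x.1 + w * cayley x.2, x.2)
  map_add' x y := by
    ext1
    · simp [cayley_add, mul_add]; abel
    · simp
  map_smul' c x := by ext1 <;> simp [cayley_smul, mul_smul_comm]
  invFun x := (x.1 - w * cayley x.2, x.2)
  left_inv x := by simp
  right_inv x := by simp

/-- The transvection `(c, d) ↦ (c, d - c~ w)` of the opposite space, which together with
`transvection w` forms an automorphism. -/
def transvection' (w : Octonion R) : OctPair R ≃ₗ[R] OctPair R where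
  toFun x := (x.1, x.2 - cayley x.1 * w)
  map_add' x y := by
    ext1
    · simp
    · simp [cayley_add, add_mul]; abel
  map_smul' c x := by ext1 <;> simp [cayley_smul, smul_mul_assoc, smul_sub]
  invFun x := (x.1, x.2 + cayley x.1 * w)
  left_inv x := by simp
  right_inv x := by simp

@[simp] theorem transvection_apply (w : Octonion R) (x : OctPair R) :
    transvection w x = (x.1 + w * cayley x.2, x.2) := rfl

@[simp] theorem transvection'_apply (w : Octonion R) (x : OctPair R) :
    transvection' w x = (x.1, x.2 - cayley x.1 * w) := rfl

theorem sharp_transvection (w : Octonion R) (x : OctPair R) :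
    sharp (transvection w x) =
      (n x.1 + bil (x.1 * x.2) w + n w * n x.2, n x.2, x.1 * x.2 + n x.2 • w) := by
  simp only [sharp, transvection_apply, n_add, n_mul, n_cayley, add_mul, mul_cayley_mul]
  rw [bil_mul_right]
  ring_nf

theorem sharp_transvection' (w : Octonion R) (x : OctPair R) :
    sharp (transvection' w x) =
      (n x.1, n x.2 - bil (x.1 * x.2) w + n w * n x.1, x.1 * x.2 - n x.1 • w) := by
  have h : n (x.2 - cayley x.1 * w) = n x.2 + n x.1 * n w - bil x.2 (cayley x.1 * w) := by
    rw [sub_eq_add_neg, ← neg_one_smul R, n_add, n_smul, bil_smul_right, n_mul, n_cayley]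
    ring
  simp only [sharp, transvection'_apply, h, mul_sub, mul_cayley_mul_self]
  rw [bil_mul_left]
  ring_nf

theorem form_transvection (w : Octonion R) (x y : OctPair R) :
    form (transvection w x) (transvection' w y) = form x y := by
  have h : bil (w * cayley x.2) y.1 = bil x.2 (cayley y.1 * w) := by
    rw [bil_mul_left, bil_cayley, cayley_mul, cayley_cayley]
  simp only [form_apply, transvection_apply, transvection'_apply, bil_add_left, h, sub_eq_add_neg,
    bil_add_right, bil_neg_right]
  ring

theorem transvection_act_sharp (w : Octonion R) (x y : OctPair R) :
    transvection w (act (sharp x) y) = act (sharp (transvection w x)) (transvection' w y) := by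
  have h := mul_cayley_mul_add (x.1 * x.2) y.1 w
  have h' := mul_cayley_mul_self w y.1
  rw [sharp_transvection]
  ext1
  · simp only [act_apply, sharp, transvection_apply, transvection'_apply, cayley_add, cayley_sub,
      cayley_mul, cayley_smul, cayley_cayley, mul_add, add_mul, mul_sub, smul_mul_assoc,
      mul_smul_comm] at h ⊢
    linear_combination (norm := module) h + n x.2 • h'
  · simp only [act_apply, sharp, transvection_apply, transvection'_apply, mul_add, mul_smul_comm]
    module

theorem transvection'_act_sharp (w : Octonion R) (x y : OctPair R) :
    transvection' w (act (sharp y) x) = act (sharp (transvection' w y)) (transvection w x) := by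
  have h := mul_cayley_mul_add' x.2 (y.1 * y.2) w
  have h' := mul_cayley_mul x.2 w
  rw [sharp_transvection']
  ext1
  · simp only [act_apply, sharp, transvection_apply, transvection'_apply, sub_mul, smul_mul_assoc]
    module
  · simp only [act_apply, sharp, transvection_apply, transvection'_apply, cayley_add, cayley_mul,
      cayley_smul, cayley_cayley, add_mul, mul_sub, smul_mul_assoc, mul_smul_comm] at h ⊢
    linear_combination (norm := module) -h + n y.1 • h'

theorem sharpForm_transvection (w : Octonion R) (x y : OctPair R) :
    sharpForm (sharp (transvection w x)) (sharp (transvection' w y)) =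
      sharpForm (sharp x) (sharp y) := by
  rw [sharp_transvection, sharp_transvection']
  simp only [sharpForm_apply, sharp, sub_eq_add_neg, bil_add_left, bil_add_right, bil_smul_left,
    bil_neg_right, bil_smul_right, bil_self]
  rw [bil_comm w]
  ring

theorem isAutomorphism_transvection (w : Octonion R) :
    IsAutomorphism (transvection w) (transvection' w) where
  map_quad x y := by
    rw [quad_apply, quad_apply, form_transvection, map_sub, map_smul, transvection_act_sharp]
  map_quad' x y := by
    rw [quad_apply, quad_apply, form_comm (transvection' w y), form_transvection, form_comm y,
      map_sub, map_smul, transvection'_act_sharp]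
  form := form_transvection w
  sharpForm := sharpForm_transvection w

/-- The exchange of the components. -/
def swap : OctPair R ≃ₗ[R] OctPair R where
  toFun x := (cayley x.2, cayley x.1)
  map_add' x y := by ext1 <;> simp [cayley_add]
  map_smul' c x := by ext1 <;> simp [cayley_smul]
  invFun x := (cayley x.2, cayley x.1)
  left_inv x := by simp
  right_inv x := by simp

@[simp] theorem swap_apply (x : OctPair R) : swap x = (cayley x.2, cayley x.1) := rfl

theorem swap_quad (x y : OctPair R) : swap (quad x y) = quad (swap x) (swap y) := by
  ext1
  · rw [quad_fst]
    simp [quad_snd, cayley_add, cayley_sub, cayley_smul, cayley_mul, bil_cayley]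
  · rw [quad_snd]
    simp [quad_fst, cayley_add, cayley_sub, cayley_smul, cayley_mul, bil_cayley]

theorem isAutomorphism_swap : IsAutomorphism (swap (R := R)) swap where
  map_quad := swap_quad
  map_quad' x y := swap_quad y x
  form x y := by simp [form_apply, bil_cayley, add_comm]
  sharpForm x y := by simp [sharpForm_apply, sharp, ← cayley_mul, bil_cayley, add_comm]

theorem quad_of_fst {x : OctPair R} (hx : x.1 = 0) (y : OctPair R) :
    quad x y = (0, bil x.2 y.2 • x.2 - n x.2 • y.2) := by
  ext1
  · simp [quad_fst, hx]
  · simp [quad_snd, hx]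

theorem trip_quad_of_fst {x : OctPair R} (hx : x.1 = 0) (y u : OctPair R) :
    trip x y (quad x u) = quad x (trip y x u) := by
  rw [quad_of_fst hx, quad_of_fst hx]
  ext1
  · simp [trip_fst, hx]
  · simp only [trip_snd, hx, bil_add_left, bil_smul_left, bil_smul_right, bil_add_right,
      sub_eq_add_neg, ← neg_smul, smul_add, smul_smul, cayley_zero, zero_mul, mul_zero, add_zero,
      bil_self]
    rw [bil_comm u.2 x.2, bil_comm y.2 x.2, bil_comm u.2 y.2]
    module

theorem trip_quad_self_of_fst {x : OctPair R} (hx : x.1 = 0) (y z : OctPair R) :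
    trip (quad x y) y z = trip x (quad y x) z := by
  have h := mul_cayley_mul_add' (y.1 * x.2) y.2 x.2
  rw [mul_mul_cayley_self, smul_mul_assoc] at h
  rw [quad_of_fst hx]
  ext1
  · simp only [trip_fst, hx, quad_snd, sub_eq_add_neg, ← neg_smul, cayley_add, cayley_smul, mul_add,
      add_mul, mul_smul_comm, smul_mul_assoc, mul_mul_cayley_self, bil_zero_left, zero_smul,
      mul_zero, zero_mul, add_zero, smul_zero, bil_comm x.2 y.2]
    module
  · simp only [trip_snd, quad_fst, quad_snd, hx, sub_eq_add_neg, ← neg_smul, bil_add_left,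
      bil_smul_left, bil_smul_right, bil_add_right, mul_add, mul_smul_comm, bil_self,
      eq_sub_of_add_eq h, zero_smul, mul_zero, zero_mul, add_zero, zero_add, cayley_zero,
      smul_zero, neg_zero, bil_zero_right, bil_comm x.2 y.2, bil_comm z.2 y.2,
      bil_comm z.2 x.2]
    module

theorem trip_quad_left_of_fst {x : OctPair R} (hx : x.1 = 0) (y : OctPair R) :
    trip x y (quad x y) =
      (2 : R) • (form x y • quad x y - sharpForm (sharp x) (sharp y) • x) := by
  rw [quad_of_fst hx]
  ext1
  · simp [trip_fst, hx]
  · simp only [trip_snd, hx, sharpForm_apply, sharp, form_apply, sub_eq_add_neg, ← neg_smul,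
      bil_add_left, bil_smul_left, bil_smul_right, bil_add_right, bil_self, bil_zero_left,
      cayley_zero, zero_mul, add_zero, zero_add, Prod.smul_snd, Prod.snd_add, smul_add, smul_smul,
      n_zero]
    module

end CommRing

section IsDomain

variable {R : Type} [CommRing R] [IsDomain R] [NeZero (2 : R)]

/-- The quadratic form of the space of adjoints. The pure spinor identity `sharp_act` holds on its
null cone, which contains all adjoints. -/
def sharpNorm (s : OctSharp R) : R := s.1 * s.2.1 - n s.2.2

omit [IsDomain R] [NeZero (2 : R)] in
theorem sharpNorm_sharp (x : OctPair R) : sharpNorm (sharp x) = 0 := by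
  simp [sharpNorm, sharp, n_mul]

theorem sharp_act {s : OctSharp R} (hs : sharpNorm s = 0) (y : OctPair R) :
    sharp (act s y) = sharpForm s (sharp y) • s := by
  have h : n s.2.2 = s.1 * s.2.1 := (sub_eq_zero.1 hs).symm
  have h₁ : bil y.1 (s.2.2 * cayley y.2) = bil s.2.2 (y.1 * y.2) := by
    rw [bil_comm, bil_mul_right, cayley_cayley]
  have h₂ : bil y.2 (cayley y.1 * s.2.2) = bil s.2.2 (y.1 * y.2) := by
    rw [bil_comm, bil_mul_left, cayley_cayley]
  have h₃ : s.2.2 * cayley y.2 * (cayley y.1 * s.2.2) =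
      bil s.2.2 (y.1 * y.2) • s.2.2 - n s.2.2 • (y.1 * y.2) := by
    rw [middle_moufang, ← cayley_mul, cayley_cayley]
  ext1
  · simp only [sharp, act_apply, n_add, n_smul, n_mul, n_cayley, bil_smul_left, h, h₁,
      sharpForm_apply, Prod.smul_fst, smul_eq_mul]
    ring
  ext1
  · simp only [sharp, act_apply, n_add, n_smul, n_mul, n_cayley, bil_smul_left, h, h₂,
      sharpForm_apply, Prod.smul_fst, Prod.smul_snd, smul_eq_mul]
    ring
  · simp only [sharp, act_apply, sharpForm_apply, Prod.smul_snd, add_mul, mul_add, smul_mul_assoc,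
      mul_smul_comm, h₃, mul_cayley_mul_self, mul_cayley_mul, h]
    module

theorem trace_trip (x y : OctPair R) : LinearMap.trace R _ (trip x y) = 12 * form x y := by
  have h₁ : LinearMap.fst R _ _ ∘ₗ trip x y ∘ₗ LinearMap.inl R _ (Octonion R) =
      bil x.1 y.1 • LinearMap.id + (bilForm y.1).smulRight x.1 - (bilForm x.1).smulRight y.1
        + rightOp y.2 x.2 := by
    ext1 u
    simp [trip_fst, bil_comm u]
  have h₂ : LinearMap.snd R _ _ ∘ₗ trip x y ∘ₗ LinearMap.inr R (Octonion R) _ =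
      bil x.2 y.2 • LinearMap.id + (bilForm y.2).smulRight x.2 - (bilForm x.2).smulRight y.2
        + leftOp y.1 x.1 := by
    ext1 u
    simp [trip_snd, bil_comm u]
  rw [trace_prod_eq_add, h₁, h₂]
  simp only [map_add, map_sub, map_smul, LinearMap.trace_id, finrank_octonion,
    LinearMap.trace_smulRight, trace_rightOp, trace_leftOp, bilForm_apply, form_apply, smul_eq_mul]
  rw [bil_comm y.1, bil_comm y.2]
  push_cast
  ring

theorem det_bergman_of_fst {x : OctPair R} (hx : x.1 = 0) (y : OctPair R) :
    LinearMap.det (bergman x y) =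
      (1 - form x y + sharpForm (sharp x) (sharp y)) ^ 12 := by
  have h₁ : LinearMap.fst R _ _ ∘ₗ bergman x y ∘ₗ LinearMap.inl R _ (Octonion R) =
      1 - rightOp y.2 x.2 := by
    ext1 u
    simp [bergman_apply, trip_fst, quad_fst, hx]
  have h₂ : LinearMap.snd R _ _ ∘ₗ bergman x y ∘ₗ LinearMap.inr R (Octonion R) _ =
      (1 - bil x.2 y.2 + n x.2 * n y.2) • LinearMap.id
        + ((bil x.2 y.2 - 1) • bilForm y.2 - n y.2 • bilForm x.2).smulRight x.2
        + (bilForm x.2 - n x.2 • bilForm y.2).smulRight y.2 := by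
    ext1 u
    simp only [LinearMap.comp_apply, LinearMap.snd_apply, LinearMap.inr_apply, bergman_apply,
      Prod.snd_add, Prod.snd_sub, trip_snd, quad_snd, quad_fst, hx, LinearMap.add_apply,
      LinearMap.sub_apply, LinearMap.smul_apply, LinearMap.smulRight_apply, bilForm_apply,
      LinearMap.id_apply, smul_eq_mul, bil_comm u y.2]
    simp only [cayley_zero, zero_mul, mul_zero, add_zero, bil_add_right, bil_smul_right,
      sub_eq_add_neg, ← neg_smul, smul_add, smul_zero]
    module
  rw [det_prod_eq_mul _ fun v => by simp [bergman_apply, trip_fst, quad_fst, hx], h₁, h₂,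
    det_one_sub_rightOp, det_octonion_bergman]
  simp only [form_apply, sharpForm_apply, sharp, hx, bil_zero_left, zero_mul, zero_add, add_zero,
    n_zero, bil_comm y.2]
  ring

end IsDomain

section Field

variable {K : Type} [Field K] [NeZero (2 : K)]

theorem exists_bil_eq_one {b : Octonion K} (hb : b ≠ 0) : ∃ c, bil b c = 1 := by
  obtain ⟨z, hz⟩ : ∃ z, bil b z ≠ 0 := by
    by_contra! h
    exact hb (eq_of_bil_eq fun z => by rw [h, bil_zero_left])
  exact ⟨(bil b z)⁻¹ • z, by rw [bil_smul_right, inv_mul_cancel₀ hz]⟩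

omit [NeZero (2 : K)] in
theorem exists_isAutomorphism_of_n_snd {x : OctPair K} (hx : n x.2 ≠ 0) :
    ∃ g g', IsAutomorphism g g' ∧ (g x).1 = 0 := by
  refine ⟨_, _, isAutomorphism_transvection (-(n x.2)⁻¹ • (x.1 * x.2)), ?_⟩
  simp [smul_mul_assoc, mul_mul_cayley_self, smul_smul, hx]

omit [NeZero (2 : K)] in
theorem exists_isAutomorphism_of_n_fst {x : OctPair K} (hx : n x.1 ≠ 0) :
    ∃ g g', IsAutomorphism g g' ∧ (g x).1 = 0 := by
  obtain ⟨g, g', hg, h⟩ := exists_isAutomorphism_of_n_snd (x := swap x) (by simpa)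
  exact ⟨_, _, isAutomorphism_swap.trans hg, by simpa using h⟩

theorem exists_isAutomorphism (x : OctPair K) :
    ∃ g g', IsAutomorphism g g' ∧ (g x).1 = 0 := by
  by_cases h₂ : n x.2 ≠ 0
  · exact exists_isAutomorphism_of_n_snd h₂
  by_cases h₁ : n x.1 ≠ 0
  · exact exists_isAutomorphism_of_n_fst h₁
  push Not at h₁ h₂
  by_cases hb : x.2 = 0
  · exact ⟨_, _, isAutomorphism_swap, by simp [hb]⟩
  by_cases h : x.1 * x.2 = 0
  · obtain ⟨f, hf⟩ := exists_bil_eq_one hb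
    refine ⟨_, _, isAutomorphism_transvection (-(x.1 * f)), ?_⟩
    have h' := mul_mul_cayley_add x.1 x.2 f
    rw [h, hf, zero_mul, zero_add, one_smul] at h'
    simp [h']
  · obtain ⟨w, hw⟩ := exists_bil_eq_one h
    have hn : n (transvection w x).1 = 1 := by
      simpa [sharp, h₁, h₂, hw] using congrArg Prod.fst (sharp_transvection w x)
    obtain ⟨g, g', hg, h'⟩ := exists_isAutomorphism_of_n_fst (hn ▸ one_ne_zero)
    exact ⟨_, _, (isAutomorphism_transvection w).trans hg, h'⟩

theorem trip_quad (x y u : OctPair K) : trip x y (quad x u) = quad x (trip y x u) := by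
  obtain ⟨g, g', hg, h⟩ := exists_isAutomorphism x
  apply g.injective
  rw [hg.map_trip, hg.map_quad, hg.map_quad, hg.symm.map_trip, trip_quad_of_fst h]

theorem trip_quad_self (x y z : OctPair K) : trip (quad x y) y z = trip x (quad y x) z := by
  obtain ⟨g, g', hg, h⟩ := exists_isAutomorphism x
  apply g.injective
  rw [hg.map_trip, hg.map_trip, hg.map_quad, hg.map_quad', trip_quad_self_of_fst h]

theorem trip_quad_left (x y : OctPair K) : trip x y (quad x y) =
    (2 : K) • (form x y • quad x y - sharpForm (sharp x) (sharp y) • x) := by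
  obtain ⟨g, g', hg, h⟩ := exists_isAutomorphism x
  apply g.injective
  simp only [hg.map_trip, map_smul, map_sub, hg.map_quad, ← hg.form x, ← hg.sharpForm x,
    trip_quad_left_of_fst h]

theorem det_bergman (x y : OctPair K) : LinearMap.det (bergman x y) =
    (1 - form x y + sharpForm (sharp x) (sharp y)) ^ 12 := by
  obtain ⟨g, g', hg, h⟩ := exists_isAutomorphism x
  rw [← hg.form, ← hg.sharpForm, ← det_bergman_of_fst h, ← LinearMap.det_conj _ g]
  congr 1
  refine LinearMap.ext fun z => ?_
  simp [bergman_apply, hg.map_trip, hg.map_quad, hg.map_quad']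

end Field

end OctPair

/-! ### Complex conjugation -/

namespace Octonion

theorem cconj_mul (x y : Octonion ℂ) : cconj (x * y) = cconj x * cconj y := by
  ext <;> simp [cconj, mul_def]

theorem cconj_cayley (x : Octonion ℂ) : cconj (cayley x) = cayley (cconj x) := by
  ext <;> simp [cconj, cayley]

@[simp] theorem cconj_cconj (x : Octonion ℂ) : cconj (cconj x) = x := by
  ext <;> simp [cconj]

theorem n_cconj (x : Octonion ℂ) : n (cconj x) = conj (n x) := by
  simp [n, cconj, Quaternion.normSq_def']

theorem bil_cconj (x y : Octonion ℂ) : bil (cconj x) (cconj y) = conj (bil x y) := by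
  simp [bil, ← cconj_add, n_cconj]

theorem repr_cconj (x : Octonion ℂ) (i : Fin 8) :
    (basis ℂ).repr (cconj x) i = conj ((basis ℂ).repr x i) := by
  fin_cases i <;> simp [basis, coords_apply, cconj]

/-- The Hermitian length `(x : x̄)` of a complex octonion, as a real number. -/
def hermSq (x : Octonion ℂ) : ℝ := 2 * ∑ i, Complex.normSq ((basis ℂ).repr x i)

theorem bil_cconj_self (x : Octonion ℂ) : bil x (cconj x) = hermSq x := by
  simp [hermSq, bil_eq_sum, repr_cconj, Complex.mul_conj]

theorem hermSq_nonneg (x : Octonion ℂ) : 0 ≤ hermSq x :=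
  mul_nonneg zero_le_two (Finset.sum_nonneg fun _ _ => Complex.normSq_nonneg _)

theorem hermSq_eq_zero {x : Octonion ℂ} : hermSq x = 0 ↔ x = 0 := by
  refine ⟨fun h => (basis ℂ).repr.injective (Finsupp.ext fun i => ?_), by rintro rfl; simp [hermSq]⟩
  rw [hermSq, mul_eq_zero, or_iff_right two_ne_zero,
    Finset.sum_eq_zero_iff_of_nonneg fun i _ => Complex.normSq_nonneg _] at h
  simpa using h i (Finset.mem_univ i)

theorem two_mul_norm_n_le (x : Octonion ℂ) : 2 * ‖n x‖ ≤ hermSq x := by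
  have h : n x = ∑ i, (basis ℂ).repr x i * (basis ℂ).repr x i :=
    mul_left_cancel₀ two_ne_zero (by rw [← bil_self, bil_eq_sum])
  rw [hermSq, h]
  gcongr
  refine (norm_sum_le _ _).trans (Finset.sum_le_sum fun i _ => ?_)
  rw [norm_mul, Complex.norm_mul_self_eq_normSq]

theorem hermSq_mul_le (x y : Octonion ℂ) : hermSq (x * y) ≤ hermSq x * hermSq y := by
  have h : (hermSq (x * y) + hermSq (cconj x * y) : ℂ) = hermSq x * hermSq y := by
    simp only [← bil_cconj_self, cconj_mul, cconj_cconj]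
    exact bil_mul_mul_add x y (cconj x) (cconj y)
  have h' : hermSq (x * y) + hermSq (cconj x * y) = hermSq x * hermSq y := by exact_mod_cast h
  linarith [hermSq_nonneg (cconj x * y)]

end Octonion

namespace OctPair

/-- Complex conjugation of pairs. -/
def conjPair : OctPair ℂ →ₗ⋆[ℂ] OctPair ℂ where
  toFun x := (cconj x.1, cconj x.2)
  map_add' x y := by simp [cconj_add]
  map_smul' c x := by simp [cconj_smul]

theorem conjPair_apply (x : OctPair ℂ) : conjPair x = (cconj x.1, cconj x.2) := rfl

/-- Complex conjugation on the space of adjoints. -/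
def conjSharp (s : OctSharp ℂ) : OctSharp ℂ := (conj s.1, conj s.2.1, cconj s.2.2)

@[simp] theorem conjPair_conjPair (x : OctPair ℂ) : conjPair (conjPair x) = x := by
  simp [conjPair_apply]

theorem form_conjPair (x y : OctPair ℂ) : form (conjPair x) (conjPair y) = conj (form x y) := by
  simp [form_apply, conjPair_apply, bil_cconj]

theorem sharp_conjPair (x : OctPair ℂ) : sharp (conjPair x) = conjSharp (sharp x) := by
  simp [sharp, conjPair_apply, conjSharp, n_cconj, cconj_mul]

theorem conjPair_act (s : OctSharp ℂ) (y : OctPair ℂ) :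
    conjPair (act s y) = act (conjSharp s) (conjPair y) := by
  simp [act_apply, conjPair_apply, conjSharp, cconj_add, cconj_smul, cconj_mul, cconj_cayley]

theorem conjPair_quad (x y : OctPair ℂ) :
    conjPair (quad x y) = quad (conjPair x) (conjPair y) := by
  simp [quad_apply, conjPair_act, sharp_conjPair, form_conjPair]

theorem conjPair_trip (x y z : OctPair ℂ) :
    conjPair (trip x y z) = trip (conjPair x) (conjPair y) (conjPair z) := by
  simp only [trip_eq_quad_sub, map_sub, conjPair_quad, map_add]

theorem form_conjPair_self (x : OctPair ℂ) :
    form x (conjPair x) = (hermSq x.1 + hermSq x.2 : ℝ) := by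
  simp [form_apply, conjPair_apply, bil_cconj_self]

theorem sharpForm_conjSharp_self (s : OctSharp ℂ) : sharpForm s (conjSharp s) =
    (Complex.normSq s.1 + Complex.normSq s.2.1 + hermSq s.2.2 : ℝ) := by
  simp [sharpForm_apply, conjSharp, bil_cconj_self, Complex.mul_conj]

theorem hermSq_add_hermSq_pos {x : OctPair ℂ} (hx : x ≠ 0) : 0 < hermSq x.1 + hermSq x.2 := by
  refine (add_nonneg (hermSq_nonneg _) (hermSq_nonneg _)).lt_of_ne' fun h => hx ?_
  rw [add_eq_zero_iff_of_nonneg (hermSq_nonneg _) (hermSq_nonneg _)] at h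
  exact Prod.ext (hermSq_eq_zero.1 h.1) (hermSq_eq_zero.1 h.2)

theorem eq_zero_of_sharpForm_conjSharp_self {s : OctSharp ℂ} (h : sharpForm s (conjSharp s) = 0) :
    s = 0 := by
  rw [sharpForm_conjSharp_self, Complex.ofReal_eq_zero] at h
  have h₁ := Complex.normSq_nonneg s.1
  have h₂ := Complex.normSq_nonneg s.2.1
  have h₃ := hermSq_nonneg s.2.2
  exact Prod.ext (Complex.normSq_eq_zero.1 (by linarith)) (Prod.ext
    (Complex.normSq_eq_zero.1 (by linarith)) (hermSq_eq_zero.1 (by linarith)))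

theorem two_mul_sharpForm_lt {x : OctPair ℂ} (hx : x ≠ 0) :
    2 * (sharpForm (sharp x) (conjSharp (sharp x))).re < (form x (conjPair x)).re ^ 2 := by
  have h : 0 < hermSq x.1 ^ 2 + hermSq x.2 ^ 2 := by
    nlinarith [hermSq_add_hermSq_pos hx, sq_nonneg (hermSq x.1 - hermSq x.2)]
  have h₁ : (2 * ‖n x.1‖) ^ 2 ≤ hermSq x.1 ^ 2 := by gcongr; exact two_mul_norm_n_le _
  have h₂ : (2 * ‖n x.2‖) ^ 2 ≤ hermSq x.2 ^ 2 := by gcongr; exact two_mul_norm_n_le _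
  rw [form_conjPair_self, sharpForm_conjSharp_self, Complex.ofReal_re, Complex.ofReal_re]
  simp only [sharp, Complex.normSq_eq_norm_sq]
  nlinarith [hermSq_mul_le x.1 x.2]

end OctPair

/-! ### Tripotents and invariant forms -/

namespace TripleProduct

open LinearMap

variable {V : Type} [AddCommGroup V] [Module ℂ V] {T : TripleProduct V}

theorem Q_apply (x y : V) : T.Q x y = (1 / 2 : ℂ) • T x y x := rfl

theorem triple_self (x y : V) : T x y x = (2 : ℂ) • T.Q x y := by
  rw [Q_apply, smul_smul]; norm_num

theorem Q_smul (c : ℂ) (x y : V) : T.Q (c • x) y = c ^ 2 • T.Q x y := by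
  simp only [Q_apply, map_smul, LinearMap.smul_apply]
  module

theorem span_range_pow {x y : V} (h : T x y (T.Q x y) ∈ Submodule.span ℂ {x, T.Q x y}) :
    Submodule.span ℂ (Set.range (T.pow x y)) = Submodule.span ℂ {x, T.Q x y} := by
  refine le_antisymm (Submodule.span_le.2 ?_) (Submodule.span_mono ?_)
  · have hmap : Submodule.span ℂ {x, T.Q x y} ≤ (Submodule.span ℂ {x, T.Q x y}).comap (T x y) := by
      rw [Submodule.span_le, Set.pair_subset_iff]
      refine ⟨?_, h⟩
      rw [SetLike.mem_coe, Submodule.mem_comap, triple_self]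
      exact Submodule.smul_mem _ _ (Submodule.subset_span (by simp))
    rintro _ ⟨k, rfl⟩
    induction k with
    | zero => exact Submodule.subset_span (by simp [pow])
    | succ k ih => exact Submodule.smul_mem _ _ (hmap ih)
  · exact Set.pair_subset ⟨0, rfl⟩ ⟨1, rfl⟩

/-- The square of the antilinear operator `Q(x)`, which is linear. -/
def QSq (T : TripleProduct V) (x : V) : V →ₗ[ℂ] V := (T.Q x).comp (T.Q x)

theorem QSq_apply (x z : V) : T.QSq x z = T.Q x (T.Q x z) := rfl

theorem IsTripotent.triple_self {e : V} (he : T.IsTripotent e) : T e e e = (2 : ℂ) • e := by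
  rw [TripleProduct.triple_self, he]

namespace IsHermitianJTS

variable (hT : T.IsHermitianJTS)

include hT

theorem Q_add (x y z : V) : T.Q (x + y) z = T.Q x z + T.Q y z + T x z y := by
  simp only [Q_apply, map_add, LinearMap.add_apply, hT.symm y z x]
  module

theorem triple_Q (x y u : V) : T x y (T.Q x u) = T.Q x (T y x u) := hT.jordan₁ x y u

theorem triple_Q_left (x y z : V) : T (T.Q x y) y z = T x (T.Q y x) z :=
  LinearMap.congr_fun (hT.jordan₂ x y) z

theorem triple_Q_add (x y z u : V) :
    T x y (T x u z) + T z y (T.Q x u) = T.Q x (T y z u) + T x (T y x u) z := by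
  have h₁ := hT.triple_Q (x + z) y u
  have h₂ := hT.triple_Q (x + (-1 : ℂ) • z) y u
  have h₃ := hT.triple_Q z y u
  simp only [hT.Q_add, Q_smul, map_add, map_smul, map_smulₛₗ, LinearMap.add_apply,
    LinearMap.smul_apply, map_neg, map_one] at h₁ h₂
  linear_combination (norm := module) (1 / 2 : ℂ) • h₁ - (1 / 2 : ℂ) • h₂ - h₃

theorem triple_Q_left_add (x y z w : V) :
    T (T.Q x y) z w + T (T.Q x z) y w = T x (T y x z) w := by
  have h := hT.triple_Q_left x (y + z) w
  simp only [hT.Q_add, map_add, LinearMap.add_apply, hT.triple_Q_left] at h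
  linear_combination (norm := module) h

variable {e : V} (he : T.IsTripotent e)

include he

theorem triple_triple (z : V) : T e e (T e e z) = T e e z + (2 : ℂ) • T.Q e (T.Q e z) := by
  have h := hT.triple_Q_add e e z e
  rw [he, TripleProduct.triple_self e z, he.triple_self, hT.symm z e e] at h
  simp only [map_smulₛₗ, LinearMap.smul_apply, map_ofNat] at h
  linear_combination (norm := module) h

theorem triple_Q_of_isTripotent (z : V) : T e e (T.Q e z) = (2 : ℂ) • T.Q e z := by
  have h := hT.triple_Q_left_add e e z e
  rw [he, hT.symm (T.Q e z), TripleProduct.triple_self, TripleProduct.triple_self,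
    ← hT.triple_Q] at h
  linear_combination (norm := module) -h

theorem Q_Q_Q (z : V) : T.Q e (T.Q e (T.Q e z)) = T.Q e z := by
  have h := hT.triple_triple he (T.Q e z)
  rw [hT.triple_Q_of_isTripotent he, map_smul, hT.triple_Q_of_isTripotent he] at h
  linear_combination (norm := module) -(1 / 2 : ℂ) • h

theorem isIdempotentElem_QSq : IsIdempotentElem (T.QSq e) :=
  LinearMap.ext fun z => by simp only [Module.End.mul_apply, QSq_apply, hT.Q_Q_Q he]

theorem QSq_of_triple_eq_smul {z : V} {k : ℂ} (hz : T e e z = k • z) :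
    T.QSq e z = (k * (k - 1) / 2) • z := by
  have h := hT.triple_triple he z
  rw [hz, map_smul, hz] at h
  rw [QSq_apply]
  linear_combination (norm := module) -(1 / 2 : ℂ) • h

theorem Q_eq_zero_of_triple_eq_smul {z : V} {k : ℂ} (hz : T e e z = k • z) (hk : k ≠ 2) :
    T.Q e z = 0 := by
  have h := hT.triple_Q_of_isTripotent he z
  rw [hT.triple_Q, hz, map_smulₛₗ, ← sub_eq_zero, ← sub_smul] at h
  refine (smul_eq_zero.1 h).resolve_left fun hk' => hk ?_
  rw [← Complex.conj_conj k, sub_eq_zero.1 hk', map_ofNat]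

theorem Q_eq_zero_of_triple_eq_zero {u : V} (hu : T e e u = 0) : T.Q e u = 0 :=
  hT.Q_eq_zero_of_triple_eq_smul he (k := 0) (by rw [hu, zero_smul]) two_ne_zero.symm

theorem orthogonal_of_triple_eq_zero {u : V} (hu : T e e u = 0) : T.Orthogonal e u := by
  refine LinearMap.ext fun w => ?_
  have h := hT.triple_Q_left_add e e u w
  rw [he, hT.Q_eq_zero_of_triple_eq_zero he hu, hu] at h
  change T e u w = 0
  simpa using h

/-- The complementary projection: `D(e, e)` has the eigenvalues `0`, `1`, `2`, and `Q(e)²` is the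
projection onto its eigenspace of eigenvalue `2`. -/
theorem isProj_ker_D : LinearMap.IsProj (ker (T.D e e)) (1 - T.D e e + T.QSq e) where
  map_mem z := by
    change T e e (z - T e e z + T.Q e (T.Q e z)) = 0
    rw [map_add, map_sub, hT.triple_triple he, hT.triple_Q_of_isTripotent he]
    module
  map_id z hz := by
    have hz : T e e z = (0 : ℂ) • z := by rw [zero_smul]; exact hz
    change z - T e e z + T.QSq e z = z
    rw [hT.QSq_of_triple_eq_smul he hz, hz]
    module

theorem finrank_ker_D [Module.Finite ℂ V] : (Module.finrank ℂ (ker (T.D e e)) : ℂ) =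
    Module.finrank ℂ V - trace ℂ V (T.D e e) + trace ℂ V (T.QSq e) := by
  rw [← (hT.isProj_ker_D he).trace, map_add, map_sub, trace_one]

omit he

variable {c d : V} (hc : T.IsTripotent c) (hd : T.IsTripotent d) (hcd : T.Orthogonal c d)
  (hdc : T.Orthogonal d c)

include hc hcd hdc

theorem triple_triple_of_orthogonal (z : V) : T c c (T c z d) = T c z d := by
  have h₁ : T c d = 0 := hcd
  have h₂ : T d c = 0 := hdc
  have h₃ := hT.triple_Q_add c c d z
  have h₄ := hT.triple_Q_left_add c c z d
  rw [hT.symm (T.Q c z), hc] at h₄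
  simp only [h₁, h₂, LinearMap.zero_apply, map_zero, add_zero, zero_add] at h₃ h₄
  rw [h₃, h₄]

omit hc in
theorem triple_Q_of_orthogonal (z : V) : T d d (T.Q c z) = 0 := by
  have h₁ : T c d = 0 := hcd
  have h₂ : T d c = 0 := hdc
  have h := hT.triple_Q_left_add c z d d
  have hQ : T.Q c d = 0 := by rw [Q_apply, h₁, LinearMap.zero_apply, smul_zero]
  rw [hQ, hT.symm z c d, h₂] at h
  simpa only [map_zero, LinearMap.zero_apply, add_zero, hT.symm d d] using h

theorem Q_triple_of_orthogonal (z : V) : T.Q c (T c z d) = 0 :=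
  hT.Q_eq_zero_of_triple_eq_smul hc (k := 1)
    (by rw [one_smul, hT.triple_triple_of_orthogonal hc hcd hdc]) (OfNat.one_ne_ofNat 2)

include hd

omit hc in
theorem Q_add_Q (z : V) : T.Q (c + d) (T.Q c z) = T.QSq c z := by
  have h : T d (T.Q c z) = 0 :=
    hT.orthogonal_of_triple_eq_zero hd (hT.triple_Q_of_orthogonal hcd hdc z)
  have h₁ : T.Q d (T.Q c z) = 0 := by rw [Q_apply, h, LinearMap.zero_apply, smul_zero]
  rw [hT.Q_add, h₁, hT.symm, h, LinearMap.zero_apply, add_zero, add_zero, QSq_apply]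

theorem Q_add_triple (z : V) : T.Q (c + d) (T c z d) = T c (T c z d) d := by
  rw [hT.Q_add, hT.Q_triple_of_orthogonal hc hcd hdc, hT.symm c z d,
    hT.Q_triple_of_orthogonal hd hdc hcd, zero_add, zero_add]

theorem triple_triple_eq (z : V) : T c c (T d d z) = T c (T c z d) d := by
  have h₁ : T c d = 0 := hcd
  have h₂ : T d c = 0 := hdc
  have h₃ : T c c d = 0 := by rw [hT.symm, h₂, LinearMap.zero_apply]
  have h₄ : T.Q (c + d) d = d := by
    rw [hT.Q_add, hd, Q_apply, h₁]
    simp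
  have h := hT.triple_Q_add (c + d) c z d
  rw [h₄, hT.Q_add_triple hc hd hcd hdc, hT.symm z c d] at h
  simpa [h₁, h₂, h₃] using h

theorem QSq_add : T.QSq (c + d) = T.QSq c + T.QSq d + T.D c c ∘ₗ T.D d d := by
  refine LinearMap.ext fun z => ?_
  have h : T.Q (c + d) (T.Q d z) = T.QSq d z := by
    rw [add_comm c d, hT.Q_add_Q hc hdc hcd]
  rw [QSq_apply, hT.Q_add c d z, map_add, map_add, hT.Q_add_Q hd hcd hdc, h,
    hT.Q_add_triple hc hd hcd hdc, ← hT.triple_triple_eq hc hd hcd hdc]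
  rfl

variable {p : Submodule ℂ V}

theorem isProj_peirce_one_one (hp : ∀ z, z ∈ p ↔ T c c z = z ∧ T d d z = z) :
    LinearMap.IsProj p (T.D c c ∘ₗ T.D d d) where
  map_mem z := by
    have h : (T.D c c ∘ₗ T.D d d) z = T c (T c z d) d := hT.triple_triple_eq hc hd hcd hdc z
    rw [h, hp, hT.triple_triple_of_orthogonal hc hcd hdc, hT.symm c _ d,
      hT.triple_triple_of_orthogonal hd hdc hcd]
    exact ⟨rfl, rfl⟩
  map_id z hz := by
    obtain ⟨h₁, h₂⟩ := (hp z).1 hz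
    change T c c (T d d z) = z
    rw [h₂, h₁]

theorem isProj_peirce_one_zero (hp : ∀ z, z ∈ p ↔ T c c z = z ∧ T d d z = 0) :
    LinearMap.IsProj p (T.D c c - (2 : ℂ) • T.QSq c - T.D c c ∘ₗ T.D d d) where
  map_mem z := by
    change T c c z - (2 : ℂ) • T.Q c (T.Q c z) - T c c (T d d z) ∈ p
    rw [hp, hT.triple_triple_eq hc hd hcd hdc]
    simp only [map_sub, map_smul]
    constructor
    · rw [hT.triple_triple hc, hT.triple_Q_of_isTripotent hc,
        hT.triple_triple_of_orthogonal hc hcd hdc]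
      module
    · rw [hT.triple_triple_eq hd hc hdc hcd, hT.triple_Q_of_orthogonal hcd hdc, hT.symm c _ d,
        hT.triple_triple_of_orthogonal hd hdc hcd, hT.symm c z d]
      simp
  map_id z hz := by
    obtain ⟨h₁, h₂⟩ := (hp z).1 hz
    have h₃ := hT.Q_eq_zero_of_triple_eq_smul hc (k := 1) (by rw [one_smul, h₁])
      (OfNat.one_ne_ofNat 2)
    change T c c z - (2 : ℂ) • T.Q c (T.Q c z) - T c c (T d d z) = z
    rw [h₁, h₂, h₃]
    simp

theorem isTripotent_add : T.IsTripotent (c + d) := by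
  have h₁ : T c d = 0 := hcd
  have h₂ : T d c = 0 := hdc
  have hc' : T.Q c d = 0 := by rw [Q_apply, h₁]; simp
  have hd' : T.Q d c = 0 := by rw [Q_apply, h₂]; simp
  have h₃ : T c c d = 0 := by rw [hT.symm, h₂]; simp
  change T.Q (c + d) (c + d) = c + d
  rw [hT.Q_add]
  simp only [map_add, hc', hd', h₃, h₁, LinearMap.add_apply, LinearMap.zero_apply]
  rw [hc, hd]
  abel

end IsHermitianJTS

/-- An invariant scalar product: a positive definite Hermitian form for which `D(y, x)` is the
adjoint operator of `D(x, y)`. -/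
structure IsInvariantForm (T : TripleProduct V) (B : V →ₗ[ℂ] V →ₗ⋆[ℂ] ℂ) : Prop where
  symm : ∀ x y, B y x = conj (B x y)
  pos : ∀ x, x ≠ 0 → 0 < (B x x).re
  triple : ∀ x y z w, B (T x y z) w = B z (T y x w)

namespace IsInvariantForm

variable {B : V →ₗ[ℂ] V →ₗ⋆[ℂ] ℂ} (hB : T.IsInvariantForm B)

include hB

theorem ofReal_self_re (x : V) : ((B x x).re : ℂ) = B x x := by
  rw [← Complex.conj_eq_iff_re, ← hB.symm]

theorem eq_zero {x : V} (h : B x x = 0) : x = 0 := by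
  by_contra hx
  simpa [h] using hB.pos x hx

theorem symm_eq_zero {x y : V} (h : B x y = 0) : B y x = 0 := by rw [hB.symm, h, map_zero]

theorem orthogonal_symm {x y : V} (h : T.Orthogonal x y) : T.Orthogonal y x :=
  LinearMap.ext fun z => hB.eq_zero (by
    have h' : T x y = 0 := h
    rw [D, hB.triple, h', LinearMap.zero_apply, map_zero])

theorem exists_smul_self_eq {x : V} (hx : x ≠ 0) {s : ℝ} (hs : 0 < s) :
    ∃ t : ℝ, t ≠ 0 ∧ B ((t : ℂ) • x) ((t : ℂ) • x) = s := by
  have hρ := hB.pos x hx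
  refine ⟨√(s / (B x x).re), (Real.sqrt_pos.2 (div_pos hs hρ)).ne', ?_⟩
  simp only [map_smulₛₗ, LinearMap.smul_apply, RingHom.id_apply, Complex.conj_ofReal, smul_eq_mul]
  rw [← mul_assoc, ← Complex.ofReal_mul, Real.mul_self_sqrt (div_pos hs hρ).le]
  nth_rw 2 [← hB.ofReal_self_re x]
  rw [← Complex.ofReal_mul, div_mul_cancel₀ _ hρ.ne']

variable (hT : T.IsHermitianJTS)

include hT

theorem Q_swap (x y z : V) : B (T.Q x y) z = B (T.Q x z) y := by
  simp only [Q_apply, map_smul, LinearMap.smul_apply, hB.triple, hT.symm y x z]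

theorem apply_eq_zero_of_triple_eq_zero {e u : V} (he : T.IsTripotent e) (hu : T e e u = 0) :
    B e u = 0 := by
  rw [← he, hB.Q_swap hT, hT.Q_eq_zero_of_triple_eq_zero he hu, map_zero, LinearMap.zero_apply]

end IsInvariantForm

/-- Each element satisfies a quadratic equation whose linear coefficient is given by the form `B`,
as it is the case when `B` is the generic trace of a triple system of rank two. -/
def IsQuadraticFor (T : TripleProduct V) (B : V →ₗ[ℂ] V →ₗ⋆[ℂ] ℂ) : Prop :=
  ∀ x, ∃ m : ℂ, T x x (T.Q x x) = (2 : ℂ) • (B x x • T.Q x x - m • x)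

section Quadratic

variable {B : V →ₗ[ℂ] V →ₗ⋆[ℂ] ℂ} (hT : T.IsHermitianJTS) (hB : T.IsInvariantForm B)
  (hq : T.IsQuadraticFor B) {e u : V} (he : T.IsTripotent e) (hu : T e e u = 0)

include hT hB he hu

theorem Q_add_smul_of_triple_eq_zero (t : ℝ) :
    T.Q (e + (t : ℂ) • u) (e + (t : ℂ) • u) = e + (t ^ 3 : ℂ) • T.Q u u := by
  have h₁ : T e u = 0 := hT.orthogonal_of_triple_eq_zero he hu
  have h₂ : T u e = 0 := hB.orthogonal_symm h₁
  have h₃ : T.Q u e = 0 := by rw [Q_apply, h₂]; simp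
  rw [hT.Q_add, Q_smul]
  simp only [map_add, map_smulₛₗ, LinearMap.add_apply, hT.Q_eq_zero_of_triple_eq_zero he hu, h₁,
    h₃, hu, Complex.conj_ofReal, RingHom.id_apply, LinearMap.zero_apply, smul_zero]
  rw [he]
  module

theorem triple_Q_add_smul_of_triple_eq_zero (t : ℝ) :
    T (e + (t : ℂ) • u) (e + (t : ℂ) • u) (e + (t ^ 3 : ℂ) • T.Q u u) =
      (2 : ℂ) • e + (t ^ 5 : ℂ) • T u u (T.Q u u) := by
  have h₁ : T e u = 0 := hT.orthogonal_of_triple_eq_zero he hu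
  have h₂ : T u e = 0 := hB.orthogonal_symm h₁
  have h₃ : T e e (T.Q u u) = 0 := by
    have h := hT.triple_Q_add u e e u
    simpa only [h₁, h₂, hu, LinearMap.zero_apply, map_zero, zero_add] using h
  have h₄ : T u u e = 0 := by rw [hT.symm, h₁, LinearMap.zero_apply]
  simp only [map_add, map_smulₛₗ, LinearMap.add_apply, LinearMap.smul_apply, h₁, h₂, h₃, h₄,
    he.triple_self, Complex.conj_ofReal, RingHom.id_apply, LinearMap.zero_apply, smul_zero]
  module

include hq

/-- The quadratic equation of `e + t u`; its constant term is found by pairing it with `e`. -/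
theorem quadratic_add_smul (he₀ : e ≠ 0) (t : ℝ) :
    (t ^ 5 : ℂ) • T u u (T.Q u u) =
      (2 : ℂ) • ((B e e + t ^ 2 * B u u) • (t ^ 3 : ℂ) • T.Q u u
        - (B e e + t ^ 2 * B u u - 1) • (t : ℂ) • u) := by
  have h₁ : T e u = 0 := hT.orthogonal_of_triple_eq_zero he hu
  have heu : B e u = 0 := hB.apply_eq_zero_of_triple_eq_zero hT he hu
  have hue : B u e = 0 := hB.symm_eq_zero heu
  have hQ : B (T.Q u u) e = 0 := by
    have h₂ : T u e = 0 := hB.orthogonal_symm h₁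
    rw [hB.Q_swap hT, Q_apply, h₂]
    simp
  have hS : B (T u u (T.Q u u)) e = 0 := by
    rw [hB.triple, hT.symm, h₁, LinearMap.zero_apply, map_zero]
  have hv : B (e + (t : ℂ) • u) (e + (t : ℂ) • u) = B e e + t ^ 2 * B u u := by
    simp only [map_add, map_smulₛₗ, LinearMap.add_apply, LinearMap.smul_apply, heu, hue,
      Complex.conj_ofReal, RingHom.id_apply, smul_eq_mul]
    ring
  obtain ⟨m, hm⟩ := hq (e + (t : ℂ) • u)
  rw [Q_add_smul_of_triple_eq_zero hT hB he hu, triple_Q_add_smul_of_triple_eq_zero hT hB he hu,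
    hv] at hm
  have hm' := congrArg (fun z => B z e) hm
  simp only [map_add, map_sub, map_smul, LinearMap.add_apply, LinearMap.sub_apply,
    LinearMap.smul_apply, hQ, hS, hue, smul_eq_mul, mul_zero, add_zero] at hm'
  have hρ : B e e ≠ 0 := fun h => he₀ (hB.eq_zero h)
  have hm'' : m = B e e + t ^ 2 * B u u - 1 := by
    apply mul_right_cancel₀ hρ
    linear_combination (1 / 2) * hm'
  rw [hm''] at hm
  linear_combination (norm := module) hm

theorem smul_eq_zero_of_triple_eq_zero (he₀ : e ≠ 0) : (B e e - 1) • u = 0 := by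
  have h (t : ℝ) := quadratic_add_smul hT hB hq he hu he₀ t
  have h₁ := h 1
  have h₂ := h 2
  have h₃ := h 3
  push_cast at h₁ h₂ h₃
  linear_combination (norm := module) (3 / 4 : ℂ) • h₁ - (3 / 20 : ℂ) • h₂ + (1 / 60 : ℂ) • h₃

theorem smul_Q_eq_of_triple_eq_zero (he₀ : e ≠ 0) : B e e • T.Q u u = B u u • u := by
  have h (t : ℝ) := quadratic_add_smul hT hB hq he hu he₀ t
  have h₁ := h 1
  have h₂ := h 2
  have h₃ := h 3
  push_cast at h₁ h₂ h₃
  linear_combination (norm := module) (13 / 48 : ℂ) • h₁ - (1 / 6 : ℂ) • h₂ + (1 / 48 : ℂ) • h₃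

end Quadratic

end TripleProduct

/-! ### The coordinates of `W` -/

section Coordinates

open OctPair

/-- The coordinates `(x₂, x₃)` of `x = F₂(x₂) + F₃(x₃)` in `W`. -/
def coordW : W ≃ₗ[ℂ] OctPair ℂ where
  toFun x := (x.1.off 1, x.1.off 2)
  map_add' _ _ := rfl
  map_smul' _ _ := rfl
  invFun p := ⟨⟨0, ![0, p.1, p.2]⟩, mem_W.2 ⟨rfl, rfl⟩⟩
  left_inv x := by
    obtain ⟨h₁, h₂⟩ := mem_W.1 x.2
    ext1
    ext1
    · exact h₁.symm
    · funext i
      fin_cases i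
      · exact h₂.symm
      · rfl
      · rfl
  right_inv _ := rfl

theorem coordW_apply (x : W) : coordW x = (x.1.off 1, x.1.off 2) := rfl

instance : Module.Finite ℂ W :=
  have : Module.Finite ℂ (Octonion ℂ) := .of_basis (Octonion.basis ℂ)
  Module.Finite.equiv coordW.symm

theorem finrank_W : Module.finrank ℂ W = 16 := by
  rw [coordW.finrank_eq, Module.finrank_prod, finrank_octonion]

theorem diag_W (x : W) (i : Fin 3) : x.1.diag i = 0 := congrFun (mem_W.1 x.2).1 i

theorem off_W (x : W) : x.1.off 0 = 0 := (mem_W.1 x.2).2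

/-- The scalar product `(x | y)` of `W`. -/
def hermW : W →ₗ[ℂ] W →ₗ⋆[ℂ] ℂ :=
  LinearMap.mk₂'ₛₗ _ _ (fun x y => H3.herm x y) (fun x y z => H3.herm_add_left x y z)
    (fun c x y => H3.herm_smul_left c x y) (fun x y z => H3.herm_add_right x y z)
    (fun c x y => H3.herm_smul_right c x y)

theorem hermW_apply (x y : W) : hermW x y = H3.herm x y := rfl

theorem hermW_eq (x y : W) : hermW x y = form (coordW x) (conjPair (coordW y)) := by
  simp [hermW_apply, H3.herm, H3.bil, Fin.sum_univ_three, diag_W, off_W, form_apply,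
    conjPair_apply, coordW_apply, H3.cconj]

theorem adj_eq (x : W) : H3.adj x = ⟨![0, -(sharp (coordW x)).1, -(sharp (coordW x)).2.1],
    ![cayley (sharp (coordW x)).2.2, 0, 0]⟩ := by
  ext1 <;> funext i <;> fin_cases i <;>
    simp [H3.adj, diag_W, off_W, sharp, coordW_apply, show n (0 : Octonion ℂ) = 0 by simp [n]]

theorem herm_adj (x y : W) : H3.herm (H3.adj x) (H3.adj y) =
    sharpForm (sharp (coordW x)) (conjSharp (sharp (coordW y))) := by
  simp [adj_eq, H3.herm, H3.bil, Fin.sum_univ_three, H3.cconj, sharpForm_apply, conjSharp,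
    cconj_cayley, bil_cayley]

theorem herm_adj_self_re (x : W) :
    ((H3.herm (H3.adj x) (H3.adj x)).re : ℂ) = H3.herm (H3.adj x) (H3.adj x) := by
  rw [herm_adj, sharpForm_conjSharp_self, Complex.ofReal_re]

theorem herm_adj_self_eq_zero {x : W} : H3.herm (H3.adj x) (H3.adj x) = 0 ↔ H3.adj x = 0 := by
  constructor <;> intro h
  · rw [herm_adj] at h
    rw [adj_eq, eq_zero_of_sharpForm_conjSharp_self h]
    ext1 <;> funext i <;> fin_cases i <;> simp
  · simp [h, H3.herm, H3.bil]

theorem adj_eq_zero {x : W} : H3.adj x = 0 ↔ sharp (coordW x) = 0 := by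
  rw [← herm_adj_self_eq_zero, herm_adj]
  exact ⟨eq_zero_of_sharpForm_conjSharp_self, fun h => by simp [h]⟩

theorem coordW_triple (x y z : W) : coordW (tripleW x y z) =
    trip (coordW x) (conjPair (coordW y)) (coordW z) := by
  have h : (tripleW x y z : H3) =
      hermW x y • (z : H3) + hermW z y • (x : H3) - H3.frd (H3.frd x z) (H3.cconj y) := rfl
  rw [coordW_apply, h, trip_apply, ← hermW_eq, ← hermW_eq]
  ext1 <;>
    simp [H3.off_frd, H3.diag_frd, diag_W, off_W, act_apply, OctPair.cross_apply, coordW_apply,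
      conjPair_apply, H3.cconj, cayley_add, cayley_mul, add_comm]

theorem coordW_Q (x y : W) : coordW (tripleW.Q x y) = quad (coordW x) (conjPair (coordW y)) := by
  rw [TripleProduct.Q_apply, map_smul, coordW_triple, trip_self, smul_smul]
  norm_num

theorem isHermitianJTS_tripleW : tripleW.IsHermitianJTS where
  symm x y z := coordW.injective (by rw [coordW_triple, coordW_triple, trip_comm])
  jordan₁ x y u := coordW.injective (by
    simp only [TripleProduct.D, coordW_triple, coordW_Q, conjPair_trip, conjPair_conjPair,
      trip_quad])
  jordan₂ x y := LinearMap.ext fun z => coordW.injective (by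
    simp only [TripleProduct.D, coordW_triple, coordW_Q, conjPair_quad, conjPair_conjPair,
      trip_quad_self])

theorem trace_D (x y : W) : LinearMap.trace ℂ W (tripleW.D x y) = 12 * hermW x y := by
  rw [hermW_eq, ← trace_trip, ← LinearMap.trace_conj' _ coordW]
  congr 1
  refine LinearMap.ext fun z => ?_
  rw [LinearEquiv.conj_apply_apply, TripleProduct.D, coordW_triple, LinearEquiv.apply_symm_apply]

theorem det_B (x y : W) : LinearMap.det (tripleW.B x y) =
    (1 - H3.herm x y + H3.herm (H3.adj x) (H3.adj y)) ^ 12 := by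
  rw [← hermW_apply, hermW_eq, herm_adj, ← sharp_conjPair, ← OctPair.det_bergman,
    ← LinearMap.det_conj _ coordW]
  congr 1
  refine LinearMap.ext fun z => ?_
  simp [TripleProduct.B, TripleProduct.D, coordW_triple, coordW_Q, conjPair_quad, bergman_apply]

theorem isInvariantForm_hermW : tripleW.IsInvariantForm hermW where
  symm x y := by rw [hermW_eq, hermW_eq, ← form_conjPair, conjPair_conjPair, form_comm]
  pos x hx := by
    rw [hermW_eq, form_conjPair_self, Complex.ofReal_re]
    exact hermSq_add_hermSq_pos (by simpa using hx)
  triple x y z w := by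
    rw [hermW_eq, hermW_eq, coordW_triple, coordW_triple, form_trip, conjPair_trip,
      conjPair_conjPair]

theorem triple_Q_left (x y : W) : tripleW x y (tripleW.Q x y) =
    (2 : ℂ) • (hermW x y • tripleW.Q x y - H3.herm (H3.adj x) (H3.adj y) • x) := by
  apply coordW.injective
  simp only [coordW_triple, coordW_Q, map_smul, map_sub, trip_quad_left, hermW_eq, herm_adj,
    sharp_conjPair]

theorem isQuadraticFor_hermW : tripleW.IsQuadraticFor hermW := fun x => ⟨_, triple_Q_left x x⟩

theorem hermW_Q_self (x : W) :
    hermW (tripleW.Q x x) x = hermW x x ^ 2 - 2 * H3.herm (H3.adj x) (H3.adj x) := by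
  rw [hermW_eq, coordW_Q, quad_apply, map_sub, map_smul, LinearMap.sub_apply, LinearMap.smul_apply,
    form_act, OctPair.cross_self, map_smul, sharp_conjPair, ← herm_adj, ← hermW_eq]
  simp only [smul_eq_mul]
  ring

theorem isPositive_tripleW : tripleW.IsPositive := by
  intro x c hx h
  have h₁ := two_mul_sharpForm_lt (x := coordW x) (by simpa using hx)
  have h₂ := hermW_Q_self x
  have h₃ := isInvariantForm_hermW.pos x hx
  rw [← hermW_eq, ← herm_adj] at h₁
  rw [h, map_smul, LinearMap.smul_apply, smul_eq_mul, ← isInvariantForm_hermW.ofReal_self_re,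
    ← herm_adj_self_re] at h₂
  set r := (hermW x x).re
  set m := (H3.herm (H3.adj x) (H3.adj x)).re
  have hc : c = ((r ^ 2 - 2 * m) / r : ℝ) := by
    have hr : (r : ℂ) ≠ 0 := by exact_mod_cast h₃.ne'
    push_cast
    rw [eq_div_iff hr, h₂]
  rw [hc, Complex.ofReal_im, Complex.ofReal_re]
  exact ⟨rfl, div_pos (by linarith) h₃⟩

theorem traceFormPosDef_tripleW : tripleW.TraceFormPosDef := by
  refine ⟨fun x y => ?_, fun x hx => ?_⟩
  · rw [trace_D, trace_D, isInvariantForm_hermW.symm, map_mul, map_ofNat]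
  · rw [trace_D, ← isInvariantForm_hermW.ofReal_self_re, ← Complex.ofReal_ofNat,
      ← Complex.ofReal_mul, Complex.ofReal_re]
    exact mul_pos (by norm_num) (isInvariantForm_hermW.pos x hx)

end Coordinates

/-! ### Tripotents of `W` -/

section Tripotents

open TripleProduct

/-- The elements that make up `𝓔'₁`; they are the tripotents of rank one. -/
def IsRankOne (c : W) : Prop := hermW c c = 1 ∧ H3.adj c = 0

/-- The elements that make up `𝓔'₂`; they are the tripotents of rank two. -/
def IsRankTwo (x : W) : Prop := hermW x x = 2 ∧ H3.herm (H3.adj x) (H3.adj x) = 1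

theorem ne_zero_of_hermW {x : W} (h : hermW x x ≠ 0) : x ≠ 0 := by
  rintro rfl
  exact h (by rw [map_zero])

theorem IsRankOne.ne_zero {c : W} (hc : IsRankOne c) : c ≠ 0 :=
  ne_zero_of_hermW (by rw [hc.1]; exact one_ne_zero)

theorem IsRankTwo.ne_zero {x : W} (hx : IsRankTwo x) : x ≠ 0 :=
  ne_zero_of_hermW (by rw [hx.1]; exact two_ne_zero)

theorem Q_of_adj_eq_zero {c : W} (hc : H3.adj c = 0) (z : W) : tripleW.Q c z = hermW c z • c := by
  apply coordW.injective
  rw [coordW_Q, OctPair.quad_apply, adj_eq_zero.1 hc, map_zero, LinearMap.zero_apply, sub_zero,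
    map_smul, hermW_eq]

theorem IsRankOne.isTripotent {c : W} (hc : IsRankOne c) : tripleW.IsTripotent c := by
  rw [IsTripotent, Q_of_adj_eq_zero hc.2, hc.1, one_smul]

theorem Q_Q_self (x : W) : tripleW.Q x (tripleW.Q x x) =
    hermW x x • tripleW.Q x x - H3.herm (H3.adj x) (H3.adj x) • x := by
  have h := triple_Q_left x x
  rw [isHermitianJTS_tripleW.triple_Q, triple_self, map_smulₛₗ, map_ofNat] at h
  exact smul_right_injective W (two_ne_zero' ℂ) h

theorem IsRankTwo.isTripotent {x : W} (hx : IsRankTwo x) : tripleW.IsTripotent x := by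
  have h₁ : hermW (tripleW.Q x x) x = 2 := by rw [hermW_Q_self, hx.1, hx.2]; norm_num
  have h₂ : hermW x (tripleW.Q x x) = 2 := by rw [isInvariantForm_hermW.symm, h₁, map_ofNat]
  have h₃ : hermW (tripleW.Q x x) (tripleW.Q x x) = 2 := by
    rw [isInvariantForm_hermW.Q_swap isHermitianJTS_tripleW, Q_Q_self, hx.1, hx.2, map_sub,
      map_smul, LinearMap.sub_apply, LinearMap.smul_apply, h₁, one_smul, hx.1, smul_eq_mul]
    norm_num
  refine sub_eq_zero.1 (isInvariantForm_hermW.eq_zero ?_)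
  rw [map_sub, map_sub, LinearMap.sub_apply, LinearMap.sub_apply, h₁, h₂, h₃, hx.1]
  norm_num

theorem isTripotent_iff {x : W} :
    tripleW.IsTripotent x ↔ x = 0 ∨ IsRankOne x ∨ IsRankTwo x := by
  refine ⟨fun hx => or_iff_not_imp_left.2 fun h₀ => ?_, ?_⟩
  · have h₁ := Q_Q_self x
    have h₂ := hermW_Q_self x
    simp only [show tripleW.Q x x = x from hx] at h₁ h₂
    have h₃ : hermW x x - H3.herm (H3.adj x) (H3.adj x) = 1 := by
      refine smul_left_injective ℂ h₀ ?_
      simp only [sub_smul, one_smul, ← h₁]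
    have h₄ : (hermW x x - 1) * (hermW x x - 2) = 0 := by linear_combination -h₂ - 2 * h₃
    rcases mul_eq_zero.1 h₄ with h | h
    · exact .inl ⟨sub_eq_zero.1 h, herm_adj_self_eq_zero.1 (by linear_combination h - h₃)⟩
    · exact .inr ⟨sub_eq_zero.1 h, by linear_combination h - h₃⟩
  · rintro (rfl | hx | hx)
    · exact map_zero _
    · exact hx.isTripotent
    · exact hx.isTripotent

theorem hermW_eq_zero_of_orthogonal {x y : W} (h : tripleW.Orthogonal x y) : hermW x y = 0 := by
  have h' := trace_D x y
  rw [h, map_zero] at h'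
  simpa using h'.symm

/-- A pair of orthogonal tripotents of rank one. -/
structure IsRankOnePair (c d : W) : Prop where
  left : IsRankOne c
  right : IsRankOne d
  orthogonal : tripleW.Orthogonal c d

namespace IsRankOnePair

variable {c d : W} (h : IsRankOnePair c d)

include h

theorem symm : IsRankOnePair d c :=
  ⟨h.right, h.left, isInvariantForm_hermW.orthogonal_symm h.orthogonal⟩

theorem hermW_add : hermW (c + d) (c + d) = 2 := by
  simp only [map_add, LinearMap.add_apply, h.left.1, h.right.1,
    hermW_eq_zero_of_orthogonal h.orthogonal, hermW_eq_zero_of_orthogonal h.symm.orthogonal]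
  norm_num

theorem isRankTwo_add : IsRankTwo (c + d) := by
  have h₁ := isHermitianJTS_tripleW.isTripotent_add h.left.isTripotent h.right.isTripotent
    h.orthogonal h.symm.orthogonal
  have h₂ := h.hermW_add
  rcases isTripotent_iff.1 h₁ with h₃ | h₃ | h₃
  · simp [h₃] at h₂
  · exact absurd (h₃.1.symm.trans h₂) (by norm_num)
  · exact h₃

end IsRankOnePair

namespace IsRankTwo

variable {x : W} (hx : IsRankTwo x)

theorem adj_sub_eq_zero {c : W} (h₁ : tripleW.Q x c = c) (h₂ : hermW x c = 1)
    (h₃ : hermW c c = 1) : H3.adj (x - c : W) = 0 := by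
  set s := OctPair.sharp (coordW x)
  set c' := OctPair.conjPair (coordW c)
  have hs : coordW (x - c) = OctPair.act s c' := by
    have h := coordW_Q x c
    rw [h₁, OctPair.quad_apply, ← hermW_eq, h₂, one_smul] at h
    rw [map_sub, h, sub_sub_cancel]
  have h₄ : OctPair.sharpForm s (OctPair.sharp c') = 0 := by
    have h := OctPair.form_act s c' c'
    rw [← hs, ← hermW_eq, map_sub, LinearMap.sub_apply, h₂, h₃, sub_self, OctPair.cross_self,
      map_smul] at h
    simpa using h.symm
  rw [adj_eq_zero, hs, OctPair.sharp_act (OctPair.sharpNorm_sharp _), h₄, zero_smul]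

include hx

theorem eq_zero_of_triple_eq_zero {u : W} (hu : tripleW x x u = 0) : u = 0 := by
  have h := smul_eq_zero_of_triple_eq_zero isHermitianJTS_tripleW isInvariantForm_hermW
    isQuadraticFor_hermW hx.isTripotent hu hx.ne_zero
  rw [hx.1] at h
  norm_num at h
  exact h

theorem trace_QSq : LinearMap.trace ℂ W (tripleW.QSq x) = 8 := by
  have h := isHermitianJTS_tripleW.finrank_ker_D hx.isTripotent
  have hk : LinearMap.ker (tripleW.D x x) = ⊥ :=
    LinearMap.ker_eq_bot'.2 fun u hu => hx.eq_zero_of_triple_eq_zero hu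
  rw [hk, finrank_bot, finrank_W, trace_D, hx.1] at h
  push_cast at h
  linear_combination -h

theorem exists_Q_eq_self :
    ∃ f, tripleW.Q x f = f ∧ hermW f x = 0 ∧ hermW f f = 2 := by
  have hswap (z : W) (hz : hermW z x = 0) : hermW (tripleW.Q x z) x = 0 := by
    rw [isInvariantForm_hermW.Q_swap isHermitianJTS_tripleW, hx.isTripotent,
      isInvariantForm_hermW.symm_eq_zero hz]
  obtain ⟨z, hz₀, hz, hzx⟩ :
      ∃ z, z ≠ 0 ∧ tripleW.Q x (tripleW.Q x z) = z ∧ hermW z x = 0 := by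
    have hP := isHermitianJTS_tripleW.isIdempotentElem_QSq hx.isTripotent
    have hr : Module.finrank ℂ (LinearMap.range (tripleW.QSq x)) = 8 := by
      exact_mod_cast (LinearMap.IsIdempotentElem.isProj_range _ hP).trace.symm.trans hx.trace_QSq
    obtain ⟨⟨z, hzr⟩, hz, hz₀⟩ := Submodule.exists_mem_ne_zero_of_ne_bot
      (LinearMap.ker_ne_bot_of_finrank_lt
        (f := (hermW.flip x).domRestrict (LinearMap.range (tripleW.QSq x)))
        (by rw [hr, Module.finrank_self]; norm_num))
    exact ⟨z, fun h => hz₀ (Subtype.ext h), (LinearMap.IsIdempotentElem.mem_range_iff hP).1 hzr, hz⟩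
  obtain ⟨f, hf₀, hf, hfx⟩ : ∃ f, f ≠ 0 ∧ tripleW.Q x f = f ∧ hermW f x = 0 := by
    by_cases h : z + tripleW.Q x z = 0
    · refine ⟨Complex.I • z, smul_ne_zero Complex.I_ne_zero hz₀, ?_, ?_⟩
      · rw [map_smulₛₗ, ← neg_eq_of_add_eq_zero_right h, Complex.conj_I, neg_smul, smul_neg,
          neg_neg]
      · rw [map_smul, LinearMap.smul_apply, hzx, smul_zero]
    · refine ⟨_, h, ?_, ?_⟩
      · rw [map_add, hz, add_comm]
      · rw [map_add, LinearMap.add_apply, hzx, hswap z hzx, add_zero]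
  obtain ⟨t, -, ht⟩ := isInvariantForm_hermW.exists_smul_self_eq hf₀ two_pos
  refine ⟨(t : ℂ) • f, ?_, ?_, by simpa using ht⟩
  · rw [map_smulₛₗ, hf, Complex.conj_ofReal]
  · rw [map_smul, LinearMap.smul_apply, hfx, smul_zero]

theorem exists_eq_add : ∃ c d, IsRankOnePair c d ∧ x = c + d := by
  obtain ⟨f, hf, hfx, hff⟩ := hx.exists_Q_eq_self
  have hxf := isInvariantForm_hermW.symm_eq_zero hfx
  obtain ⟨c, hcx, hxc, hcc, hc⟩ :
      ∃ c, hermW c x = 1 ∧ hermW x c = 1 ∧ hermW c c = 1 ∧ tripleW.Q x c = c := by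
    refine ⟨(1 / 2 : ℂ) • (x + f), ?_, ?_, ?_, ?_⟩
    · simp [hx.1, hfx]
    · simp [hx.1, hxf, Complex.conj_ofNat]
    · simp [hx.1, hxf, hfx, hff, Complex.conj_ofNat]
      norm_num
    · simp [show tripleW.Q x x = x from hx.isTripotent, hf, Complex.conj_ofNat]
  have hd : H3.adj (x - c : W) = 0 := adj_sub_eq_zero hc hxc hcc
  have hdd : hermW (x - c) (x - c) = 1 := by
    simp only [map_sub, LinearMap.sub_apply, hx.1, hcx, hxc, hcc]
    norm_num
  have hc₁ : IsRankOne c := by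
    refine ⟨hcc, ?_⟩
    rw [← sub_sub_cancel (x : H3) c]
    refine adj_sub_eq_zero (c := x - c) ?_ ?_ hdd
    · rw [map_sub, hx.isTripotent, hc]
    · rw [map_sub, hx.1, hxc]; norm_num
  refine ⟨c, x - c, ⟨hc₁, ⟨hdd, hd⟩, ?_⟩, (add_sub_cancel c x).symm⟩
  refine isHermitianJTS_tripleW.orthogonal_of_triple_eq_zero hc₁.isTripotent ?_
  have h := isHermitianJTS_tripleW.triple_Q_left x c x
  rw [hc, Q_of_adj_eq_zero hc₁.2, hcx, one_smul, triple_self, hc] at h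
  rw [map_sub, h, hc₁.isTripotent.triple_self, sub_self]

end IsRankTwo

theorem IsRankOne.isMinimalTripotent {c : W} (hc : IsRankOne c) :
    tripleW.IsMinimalTripotent c := by
  refine ⟨hc.isTripotent, hc.ne_zero, fun y z hy hz hyz h => ?_⟩
  have hn {x : W} (hx : tripleW.IsTripotent x) (hx₀ : x ≠ 0) : 1 ≤ (hermW x x).re := by
    rcases isTripotent_iff.1 hx with h | h | h
    · exact absurd h hx₀
    · simp [h.1]
    · simp [h.1]
  by_contra! h₀
  have h₁ := hc.1
  rw [h, map_add, map_add, LinearMap.add_apply, LinearMap.add_apply,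
    hermW_eq_zero_of_orthogonal hyz,
    hermW_eq_zero_of_orthogonal (isInvariantForm_hermW.orthogonal_symm hyz)] at h₁
  have h₂ := congrArg Complex.re h₁
  simp only [add_zero, zero_add, Complex.add_re, Complex.one_re] at h₂
  linarith [hn hy h₀.1, hn hz h₀.2]

theorem isMinimalTripotent_iff {c : W} : tripleW.IsMinimalTripotent c ↔ IsRankOne c := by
  refine ⟨fun hc => ?_, IsRankOne.isMinimalTripotent⟩
  rcases isTripotent_iff.1 hc.1 with h | h | h
  · exact absurd h hc.2.1
  · exact h
  · obtain ⟨y, z, hyz, hc'⟩ := h.exists_eq_add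
    rcases hc.2.2 y z hyz.left.isTripotent hyz.right.isTripotent hyz.orthogonal hc' with h₀ | h₀
    · exact absurd h₀ hyz.left.ne_zero
    · exact absurd h₀ hyz.right.ne_zero

theorem IsRankOnePair.isOrthogonalSystem {c d : W} (h : IsRankOnePair c d) :
    tripleW.IsOrthogonalSystem ![c, d] := by
  refine ⟨Fin.forall_fin_two.2 ⟨h.left.isMinimalTripotent, h.right.isMinimalTripotent⟩, ?_⟩
  simp [Fin.forall_fin_two, h.orthogonal, h.symm.orthogonal]

theorem isRankOnePair_of_isOrthogonalSystem {m : ℕ} {e : Fin m → W}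
    (he : tripleW.IsOrthogonalSystem e) {i j : Fin m} (hij : i ≠ j) : IsRankOnePair (e i) (e j) :=
  ⟨isMinimalTripotent_iff.1 (he.1 i), isMinimalTripotent_iff.1 (he.1 j), he.2 i j hij⟩

theorem isTripotentOfRank_zero_iff {x : W} : tripleW.IsTripotentOfRank 0 x ↔ x = 0 := by
  constructor
  · rintro ⟨-, e, -, rfl⟩
    exact Fin.sum_univ_zero e
  · rintro rfl
    exact ⟨isTripotent_iff.2 (.inl rfl), ![], ⟨fun i => i.elim0, fun i => i.elim0⟩,
      (Fin.sum_univ_zero _).symm⟩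

theorem isTripotentOfRank_one_iff {x : W} : tripleW.IsTripotentOfRank 1 x ↔ IsRankOne x := by
  rw [← isMinimalTripotent_iff]
  constructor
  · rintro ⟨-, e, he, rfl⟩
    rw [Fin.sum_univ_one]
    exact he.1 0
  · exact fun h => ⟨h.1, ![x], ⟨fun i => by simpa using h,
      fun i j hij => absurd (Subsingleton.elim i j) hij⟩, by simp⟩

theorem isTripotentOfRank_two_iff {x : W} : tripleW.IsTripotentOfRank 2 x ↔ IsRankTwo x := by
  constructor
  · rintro ⟨-, e, he, rfl⟩
    rw [Fin.sum_univ_two]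
    exact (isRankOnePair_of_isOrthogonalSystem he zero_ne_one).isRankTwo_add
  · intro hx
    obtain ⟨c, d, h, hcd⟩ := hx.exists_eq_add
    exact ⟨hx.isTripotent, ![c, d], h.isOrthogonalSystem, by rw [Fin.sum_univ_two, hcd]; rfl⟩

end Tripotents

/-! ### Frames and numerical invariants -/

section Frames

open TripleProduct

theorem exists_eq_add_of_n_eq_zero (a : Octonion ℂ) : ∃ p q, n p = 0 ∧ n q = 0 ∧ a = p + q := by
  obtain ⟨r, h₀, h₁, h₂, h₃⟩ :
      ∃ r : ℍ[ℂ], r.re = 1 / 2 ∧ r.imI = Complex.I / 2 ∧ r.imJ = 0 ∧ r.imK = 0 :=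
    ⟨⟨1 / 2, Complex.I / 2, 0, 0⟩, rfl, rfl, rfl, rfl⟩
  have hr : n (⟨r, 0⟩ : Octonion ℂ) = 0 := by
    simp [n, Quaternion.normSq_def', h₀, h₁, h₂, h₃, div_pow]
    norm_num
  have hs : (⟨r, 0⟩ + cayley ⟨r, 0⟩ : Octonion ℂ) = ⟨1, 0⟩ := by
    have h : r + star r = 1 := by
      ext <;> simp [h₀, h₁, h₂, h₃]
      norm_num
    ext1 <;> simp [cayley, h]
  refine ⟨a * ⟨r, 0⟩, a * cayley ⟨r, 0⟩, by rw [n_mul, hr, mul_zero],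
    by rw [n_mul, n_cayley, hr, mul_zero], ?_⟩
  rw [← mul_add, hs]
  ext1 <;> simp [mul_def]

theorem span_adj_eq_zero : Submodule.span ℂ {c : W | H3.adj c = 0} = ⊤ := by
  refine Submodule.eq_top_iff'.2 fun x => ?_
  have hmem (y : OctPair ℂ) (hy : OctPair.sharp y = 0) :
      coordW.symm y ∈ Submodule.span ℂ {c : W | H3.adj c = 0} :=
    Submodule.subset_span (adj_eq_zero.2 (by rwa [LinearEquiv.apply_symm_apply]))
  obtain ⟨p, q, hp, hq, h₁⟩ := exists_eq_add_of_n_eq_zero (coordW x).1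
  obtain ⟨r, s, hr, hs, h₂⟩ := exists_eq_add_of_n_eq_zero (coordW x).2
  have hx : x = coordW.symm (p, 0) + coordW.symm (q, 0) +
      (coordW.symm (0, r) + coordW.symm (0, s)) := by
    simp only [← map_add]
    exact (LinearEquiv.eq_symm_apply _).2 (Prod.ext (by simp [h₁]) (by simp [h₂]))
  rw [hx]
  refine add_mem (add_mem (hmem _ ?_) (hmem _ ?_)) (add_mem (hmem _ ?_) (hmem _ ?_)) <;>
    simp [OctPair.sharp, hp, hq, hr, hs]

theorem exists_isRankOne_notMem {p : Submodule ℂ W} (hp : p ≠ ⊤) : ∃ c, IsRankOne c ∧ c ∉ p := by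
  obtain ⟨c, hc, hcp⟩ : ∃ c : W, H3.adj c = 0 ∧ c ∉ p := by
    by_contra! h
    exact hp (top_le_iff.1 (span_adj_eq_zero ▸ Submodule.span_le.2 h))
  have hc₀ : c ≠ 0 := fun h => hcp (h ▸ p.zero_mem)
  obtain ⟨t, ht, h⟩ := isInvariantForm_hermW.exists_smul_self_eq hc₀ one_pos
  refine ⟨(t : ℂ) • c, ⟨by simpa using h, ?_⟩, fun h => hcp ?_⟩
  · rw [adj_eq_zero] at hc ⊢
    rw [map_smul, OctPair.sharp_smul, hc, smul_zero]
  · exact (p.smul_mem_iff (Complex.ofReal_ne_zero.2 ht)).1 h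

theorem exists_isRankOne : ∃ c, IsRankOne c := by
  have : Nontrivial W := Module.nontrivial_of_finrank_pos (R := ℂ) (by rw [finrank_W]; norm_num)
  obtain ⟨c, hc, -⟩ := exists_isRankOne_notMem (bot_ne_top : (⊥ : Submodule ℂ W) ≠ ⊤)
  exact ⟨c, hc⟩

namespace IsRankOne

variable {c : W} (hc : IsRankOne c)

include hc

theorem trace_QSq : LinearMap.trace ℂ W (tripleW.QSq c) = 1 := by
  have h : tripleW.QSq c = (hermW.flip c).smulRight c := LinearMap.ext fun z => by
    rw [QSq_apply, Q_of_adj_eq_zero hc.2 z, map_smulₛₗ, hc.isTripotent,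
      ← isInvariantForm_hermW.symm]
    rfl
  rw [h, LinearMap.trace_smulRight]
  exact hc.1

theorem finrank_ker_D : Module.finrank ℂ (LinearMap.ker (tripleW.D c c)) = 5 := by
  have h := isHermitianJTS_tripleW.finrank_ker_D hc.isTripotent
  rw [finrank_W, trace_D, hc.1, hc.trace_QSq] at h
  norm_num at h
  exact_mod_cast h

theorem exists_isRankOnePair : ∃ d, IsRankOnePair c d := by
  obtain ⟨u, hu, hu₀⟩ := (LinearMap.ker (tripleW.D c c)).exists_mem_ne_zero_of_ne_bot
    (Submodule.one_le_finrank_iff.1 (by rw [hc.finrank_ker_D]; norm_num))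
  obtain ⟨t, -, ht⟩ := isInvariantForm_hermW.exists_smul_self_eq hu₀ one_pos
  set d := (t : ℂ) • u
  have hd : tripleW c c d = 0 := Submodule.smul_mem _ _ hu
  have hdd : hermW d d = 1 := by simpa using ht
  have h : tripleW.IsTripotent d := by
    have h := smul_Q_eq_of_triple_eq_zero isHermitianJTS_tripleW isInvariantForm_hermW
      isQuadraticFor_hermW hc.isTripotent hd hc.ne_zero
    rwa [hc.1, hdd, one_smul, one_smul] at h
  refine ⟨d, hc, ?_, isHermitianJTS_tripleW.orthogonal_of_triple_eq_zero hc.isTripotent hd⟩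
  rcases isTripotent_iff.1 h with h | h | h
  · simp [h] at hdd
  · exact h
  · exact absurd (h.1.symm.trans hdd) (by norm_num)

end IsRankOne

namespace IsRankOnePair

variable {c d : W} (h : IsRankOnePair c d)

include h

theorem trace_D_comp_D : LinearMap.trace ℂ W (tripleW.D c c ∘ₗ tripleW.D d d) = 6 := by
  have hQ := congrArg (LinearMap.trace ℂ W) (isHermitianJTS_tripleW.QSq_add h.left.isTripotent
    h.right.isTripotent h.orthogonal h.symm.orthogonal)
  rw [map_add, map_add, h.isRankTwo_add.trace_QSq, h.left.trace_QSq, h.right.trace_QSq] at hQ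
  linear_combination -hQ

theorem finrank_peirce_one_one {p : Submodule ℂ W}
    (hp : ∀ z, z ∈ p ↔ tripleW c c z = z ∧ tripleW d d z = z) : Module.finrank ℂ p = 6 := by
  have hP := isHermitianJTS_tripleW.isProj_peirce_one_one h.left.isTripotent h.right.isTripotent
    h.orthogonal h.symm.orthogonal hp
  exact_mod_cast hP.trace.symm.trans h.trace_D_comp_D

theorem finrank_peirce_one_zero {p : Submodule ℂ W}
    (hp : ∀ z, z ∈ p ↔ tripleW c c z = z ∧ tripleW d d z = 0) : Module.finrank ℂ p = 4 := by
  have hP := (isHermitianJTS_tripleW.isProj_peirce_one_zero h.left.isTripotent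
    h.right.isTripotent h.orthogonal h.symm.orthogonal hp).trace
  rw [map_sub, map_sub, map_smul, trace_D, h.left.1, h.left.trace_QSq, h.trace_D_comp_D] at hP
  norm_num at hP
  exact_mod_cast hP.symm

theorem eq_zero_of_orthogonal {f : W} (hc : tripleW.Orthogonal f c)
    (hd : tripleW.Orthogonal f d) : f = 0 := by
  refine h.isRankTwo_add.eq_zero_of_triple_eq_zero ?_
  have hf : tripleW f (c + d) = 0 := by
    rw [map_add, show tripleW f c = 0 from hc, show tripleW f d = 0 from hd, add_zero]
  rw [isHermitianJTS_tripleW.symm, hf, LinearMap.zero_apply]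

end IsRankOnePair

theorem isFrame_of_isOrthogonalSystem {e : Fin 2 → W} (he : tripleW.IsOrthogonalSystem e) :
    tripleW.IsFrame e := by
  refine ⟨he, fun f hf h => hf.2.1 ?_⟩
  exact (isRankOnePair_of_isOrthogonalSystem he zero_ne_one).eq_zero_of_orthogonal (h 0).2 (h 1).2

theorem length_of_isFrame {m : ℕ} {e : Fin m → W} (he : tripleW.IsFrame e) : m = 2 := by
  obtain _ | _ | _ | m := m
  · obtain ⟨c, hc⟩ := exists_isRankOne
    exact absurd (fun i => i.elim0) (he.2 c hc.isMinimalTripotent)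
  · obtain ⟨d, hd⟩ := (isMinimalTripotent_iff.1 (he.1.1 0)).exists_isRankOnePair
    refine absurd (fun i => ?_) (he.2 d hd.right.isMinimalTripotent)
    obtain rfl : i = 0 := by lia
    exact ⟨hd.orthogonal, hd.symm.orthogonal⟩
  · rfl
  · have he' {i j : Fin (m + 3)} (hij : i ≠ j) := he.1.2 i j hij
    have h₀₁ : IsRankOnePair (e 0) (e 1) := isRankOnePair_of_isOrthogonalSystem he.1 zero_ne_one
    have h₂₀ : (2 : Fin (m + 3)) ≠ 0 := by simp [Fin.ext_iff, Nat.mod_eq_of_lt]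
    have h₂₁ : (2 : Fin (m + 3)) ≠ 1 := by simp [Fin.ext_iff, Nat.mod_eq_of_lt]
    exact absurd (h₀₁.eq_zero_of_orthogonal (he' h₂₀) (he' h₂₁)) (he.1.1 2).2.1

theorem span_range_pow_tripleW (x y : W) :
    Submodule.span ℂ (Set.range (tripleW.pow x y)) =
      Submodule.span ℂ (Set.range ![x, tripleW.Q x y]) := by
  rw [Matrix.range_cons_cons_empty]
  refine span_range_pow ?_
  rw [triple_Q_left]
  exact Submodule.smul_mem _ _ (sub_mem (Submodule.smul_mem _ _ (Submodule.subset_span (by simp)))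
    (Submodule.smul_mem _ _ (Submodule.subset_span (by simp))))

theorem IsRankOnePair.linearIndependent {c d : W} (h : IsRankOnePair c d) :
    LinearIndependent ℂ ![c, d] := by
  refine (LinearIndependent.pair_iff' h.left.ne_zero).2 fun a hd => ?_
  have h₁ : hermW d d = a • hermW c d := by
    conv_lhs => rw [← hd, map_smulₛₗ hermW, LinearMap.smul_apply, hd]
    rfl
  rw [h.right.1, hermW_eq_zero_of_orthogonal h.orthogonal, smul_zero] at h₁
  exact one_ne_zero h₁

theorem IsRankOnePair.finrank_span_range_pow {c d : W} (h : IsRankOnePair c d) :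
    Module.finrank ℂ (Submodule.span ℂ (Set.range (tripleW.pow (c + d) d))) = 2 := by
  have hQ : tripleW.Q (c + d) d = d := by
    have hQ := isHermitianJTS_tripleW.Q_add_Q h.left.isTripotent h.symm.orthogonal h.orthogonal d
    rwa [QSq_apply, h.right.isTripotent, h.right.isTripotent, add_comm] at hQ
  have hli : LinearIndependent ℂ ![c + d, d] := by
    rw [LinearIndependent.pair_add_left_iff]
    exact h.linearIndependent
  rw [span_range_pow_tripleW, hQ, finrank_span_eq_card hli, Fintype.card_fin]

theorem hasRank_tripleW : tripleW.HasRank 2 := by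
  refine ⟨?_, ?_⟩
  · obtain ⟨c, hc⟩ := exists_isRankOne
    obtain ⟨d, h⟩ := hc.exists_isRankOnePair
    exact ⟨c + d, d, h.finrank_span_range_pow.symm⟩
  · rintro _ ⟨x, y, rfl⟩
    rw [span_range_pow_tripleW]
    exact finrank_range_le_card _

theorem mem_peirce {e : Fin 2 → W} {i j : Option (Fin 2)} {z : W} :
    z ∈ tripleW.peirce e i j ↔ ∀ k : Fin 2, tripleW (e k) (e k) z =
      ((if i = some k then 1 else 0) + (if j = some k then 1 else 0) : ℂ) • z := by
  simp only [TripleProduct.peirce, Submodule.mem_iInf, LinearMap.mem_ker, LinearMap.sub_apply,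
    sub_eq_zero, TripleProduct.D, LinearMap.smul_apply, LinearMap.id_apply]

theorem hasInvariants_tripleW : tripleW.HasInvariants 6 4 2 12 where
  rank := hasRank_tripleW
  exists_frame := by
    obtain ⟨c, hc⟩ := exists_isRankOne
    obtain ⟨d, h⟩ := hc.exists_isRankOnePair
    exact ⟨_, isFrame_of_isOrthogonalSystem h.isOrthogonalSystem⟩
  length_frame _ _ he := length_of_isFrame he
  dim_a e he i j hij := by
    obtain ⟨rfl, rfl⟩ : i = 0 ∧ j = 1 := by lia
    refine (isRankOnePair_of_isOrthogonalSystem he.1 zero_ne_one).finrank_peirce_one_one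
      fun z => ?_
    simp [mem_peirce, Fin.forall_fin_two]
  dim_b e he i := by
    fin_cases i
    · refine (isRankOnePair_of_isOrthogonalSystem he.1 zero_ne_one).finrank_peirce_one_zero
        fun z => ?_
      simp [mem_peirce, Fin.forall_fin_two]
    · refine (isRankOnePair_of_isOrthogonalSystem he.1 one_ne_zero).finrank_peirce_one_zero
        fun z => ?_
      simp [mem_peirce, Fin.forall_fin_two, and_comm]
  genus := by norm_num

end Frames

/-! ### Simplicity -/

section Simplicity

open TripleProduct

variable {I : Submodule ℂ W} (hI : tripleW.IsIdeal I) {c : W}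

include hI

theorem mem_of_isIdeal {u : W} (hc : H3.adj c = 0) (hu : u ∈ I) (h : hermW c u ≠ 0) : c ∈ I := by
  refine (I.smul_mem_iff h).1 ?_
  rw [← Q_of_adj_eq_zero hc]
  exact I.smul_mem _ (hI u hu c c).2.1

theorem le_ker_D_of_isIdeal (hc : H3.adj c = 0) (hcI : c ∉ I) :
    I ≤ LinearMap.ker (tripleW.D c c) := by
  intro u hu
  refine isInvariantForm_hermW.eq_zero ?_
  rw [D, isHermitianJTS_tripleW.symm, isInvariantForm_hermW.triple]
  by_contra h
  exact hcI (mem_of_isIdeal hI hc (hI u hu c _).2.1 h)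

omit hI in
theorem isSimple_tripleW : tripleW.IsSimple := by
  refine ⟨?_, fun I hI => ?_⟩
  · obtain ⟨c, hc⟩ := exists_isRankOne
    refine ⟨c, c, c, ?_⟩
    rw [hc.isTripotent.triple_self]
    exact smul_ne_zero two_ne_zero hc.ne_zero
  · by_contra! h
    obtain ⟨c, hc, hcI⟩ := exists_isRankOne_notMem h.2
    have hI₅ := Submodule.finrank_mono (le_ker_D_of_isIdeal hI hc.2 hcI)
    obtain ⟨u, hu, hu₀⟩ := I.exists_mem_ne_zero_of_ne_bot h.1
    obtain ⟨d, hd, hdu⟩ :=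
      exists_isRankOne_notMem (p := LinearMap.ker (hermW.flip u)) fun hk => hu₀ <|
        isInvariantForm_hermW.eq_zero (LinearMap.congr_fun (LinearMap.ker_eq_top.1 hk) u)
    have hdI : d ∈ I := mem_of_isIdeal hI hd.2 hu hdu
    have hrange : LinearMap.range (tripleW.D d d) ≤ I := by
      rintro _ ⟨z, rfl⟩
      exact (hI d hdI d z).1
    have h₁₁ := Submodule.finrank_mono hrange
    have h₁₆ := (tripleW.D d d).finrank_range_add_finrank_ker
    rw [finrank_W, hd.finrank_ker_D] at h₁₆
    rw [hc.finrank_ker_D] at hI₅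
    lia

end Simplicity

end ExceptionalJTS

end

open ExceptionalJTS in
theorem proposition2p18 :
    Module.finrank ℂ W = 16 ∧
    tripleW.IsHermitianJTS ∧
    tripleW.IsPositive ∧
    tripleW.TraceFormPosDef ∧
    tripleW.IsSimple ∧
    tripleW.HasInvariants 6 4 2 12 ∧
    (∀ x y : W, LinearMap.trace ℂ W (tripleW.D x y) = 12 * H3.herm x y) ∧
    (∀ x y : W, LinearMap.det (tripleW.B x y) =
      (1 - H3.herm x y + H3.herm (H3.adj x) (H3.adj y)) ^ 12) ∧
    {x : W | tripleW.IsTripotent x} =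
      {0} ∪ {x : W | H3.herm x x = 1 ∧ H3.adj x = 0} ∪
        {x : W | H3.herm x x = 2 ∧ H3.herm (H3.adj x) (H3.adj x) = 1} ∧
    {x : W | tripleW.IsTripotentOfRank 0 x} = {0} ∧
    {x : W | tripleW.IsTripotentOfRank 1 x} = {x : W | H3.herm x x = 1 ∧ H3.adj x = 0} ∧
    {x : W | tripleW.IsTripotentOfRank 2 x} =
      {x : W | H3.herm x x = 2 ∧ H3.herm (H3.adj x) (H3.adj x) = 1} :=
  ⟨finrank_W, isHermitianJTS_tripleW, isPositive_tripleW, traceFormPosDef_tripleW,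
    isSimple_tripleW, hasInvariants_tripleW, trace_D, det_B,
    Set.ext fun _ => isTripotent_iff.trans or_assoc.symm,
    Set.ext fun _ => isTripotentOfRank_zero_iff,
    Set.ext fun _ => isTripotentOfRank_one_iff,
    Set.ext fun _ => isTripotentOfRank_two_iff⟩
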